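/- \textbf{Setting.} Let $X,Z,\xi,Z',\xi'$ be mutually independent random variables with values in measurable spaces, where $Z'$ has the law of $Z$ and $\xi'$ has the law of $\xi$. Let $f$ be a measurable real function such that $Y=f(X,Z)$ is square integrable with $\mathrm{Var}(Y)\neq 0$. Put $Y^X=f(X,Z')$ and \[ S^X=\frac{\mathrm{Var}(\mathbb E(Y\mid X))}{\mathrm{Var}(Y)} . \] For every $N\ge 1$ let $\delta_N=\delta_N(X,Z,\xi)$ be a measurable real function of $(X,Z,\xi)$ (the metamodel error), let $\delta_N^X=\delta_N(X,Z',\xi')$, and let $\widetilde Y_N=Y+\delta_N$ be the output of the metamodel. Let $(X_i,Z_i,\xi_i,Z_i',\xi_i')_{i\ge1}$ be i.i.d. copies of $(X,Z,\xi,Z',\xi')$, and write \[ \widetilde Y_i=f(X_i,Z_i)+\delta_N(X_i,Z_i,\xi_i),\qquad \widetilde Y_i^X=f(X_i,Z_i')+\delta_N(X_i,Z_i',\xi_i'). \] With all sums over $i=1,\dots,N$, the metamodel-based estimators are \[ \widetilde S_N^X=\frac{\frac1N\sum \widetilde Y_i\widetilde Y_i^X-\left(\frac1N\sum\widetilde Y_i\right)\left(\frac1N\sum\widetilde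 Y_i^X\right)}{\frac1N\sum\widetilde Y_i^2-\left(\frac1N\sum\widetilde Y_i\right)^2},\qquad \widetilde T_N^X=\frac{\frac1N\sum \widetilde Y_i\widetilde Y_i^X-\left(\frac1N\sum\frac{\widetilde Y_i+\widetilde Y_i^X}{2}\right)^2}{\frac1N\sum\frac{\widetilde Y_i^2+(\widetilde Y_i^X)^2}{2}-\left(\frac1N\sum\frac{\widetilde Y_i+\widetilde Y_i^X}{2}\right)^2} \] (set to $0$ when the denominator vanishes). Let \[ \sigma_S^2=\frac{\mathrm{Var}\left((Y-\mathbb EY)\left[(Y^X-\mathbb EY)-S^X(Y-\mathbb EY)\right]\right)}{(\mathrm{Var}\,Y)^2},\] \[\sigma_T^2=\frac{\mathrm{Var}\left((Y-\mathbb EY)(Y^X-\mathbb EY)-\frac{S^X}{2}\left[(Y-\mathbb EY)^2+(Y^X-\mathbb EY)^2\right]\right)}{(\mathrm{Var}\,Y)^2}, \] and, with $\mathrm{Corr}(A,B)=\mathrm{Cov}(A,B)/\sqrt{\mathrm{Var}(A)\,\mathrm{Var}(B)}$ (read as $0$ if one of the variances vanishes), \[ C_{\delta,N}=2\,\mathrm{Var}(Y)^{1/2}\left[\mathrm{Corr}(Y,\delta_N^X)-\mathrm{Corr}(Y,Y^X)\,\mathrm{Corr}(Y,\delta_N)\right]+\mathrm{Var}(\delta_N)^{1/2}\left[\mathrm{Corr}(\delta_N,\delta_N^X)-\mathrm{Corr}(Y,Y^X)\right].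 \] \textbf{Theorem.} Assume that there are $s>0$ and $K$ with $\mathbb E|\widetilde Y_N|^{4+s}<K$ for all $N\ge1$, that $\mathrm{Var}(\delta_N)\to0$ as $N\to\infty$ (as is the case when $\delta_N$ converges to a constant in $L^2$), and that $C_{\delta,N}$ does not converge to $0$. All limits are as $N\to\infty$, limits of random variables are in distribution, and $\mathcal N(m,0)$ is the Dirac mass at $m$. \begin{enumerate} \item If $\mathrm{Var}(\delta_N)=o(1/N)$, then $\sqrt N(\widetilde S_N^X-S^X)\to\mathcal N(0,\sigma_S^2)$ and $\sqrt N(\widetilde T_N^X-S^X)\to\mathcal N(0,\sigma_T^2)$. \item If $N\,\mathrm{Var}(\delta_N)\to\infty$, then asymptotic normality fails for both estimators: neither $\sqrt N(\widetilde S_N^X-S^X)$ nor $\sqrt N(\widetilde T_N^X-S^X)$ converges in distribution to a normal law $\mathcal N(m,v)$, for any $m\in\mathbb R$ and $v\ge0$ (in particular not to $\mathcal N(0,\sigma_S^2)$, respectively $\mathcal N(0,\sigma_T^2)$). \item If $C_{\delta,N}$ converges to a constant $C\neq0$ and if $\gamma\in\mathbb R$ is such that $\mathrm{Var}(\delta_N)=\frac{\gamma}{CN}+o\left(\frac1N\right)$,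 then (necessarily $\gamma/C\ge0$ and) \[ \sqrt N(\widetilde S_N^X-S^X)\to\mathcal N(\kappa,\sigma_S^2)\quad\text{and}\quad \sqrt N(\widetilde T_N^X-S^X)\to\mathcal N(\kappa,\sigma_T^2),\qquad \kappa=\frac{C\sqrt{\gamma/C}}{\mathrm{Var}(Y)} . \] \end{enumerate} -/

import Mathlib

open MeasureTheory ProbabilityTheory Filter Topology Asymptotics
open scoped NNReal ENNReal

namespace PickFreeze

noncomputable section

/-- The independence structure of one pick-freeze draw `(X, Z, ξ, Z', ξ')`: the five variables are
mutually independent, `Z'` is a copy of `Z` and `ξ'` is a copy of `ξ`. -/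
structure IsDraw {Ω 𝓧 𝓩 Ξ : Type*} [MeasurableSpace Ω] [MeasurableSpace 𝓧] [MeasurableSpace 𝓩]
    [MeasurableSpace Ξ] (P : Measure Ω) (X : Ω → 𝓧) (Z : Ω → 𝓩) (ξ : Ω → Ξ) (Z' : Ω → 𝓩)
    (ξ' : Ω → Ξ) : Prop where
  measurable_X : Measurable X
  measurable_Z : Measurable Z
  measurable_ξ : Measurable ξ
  measurable_Z' : Measurable Z'
  measurable_ξ' : Measurable ξ'
  indep_Z : IndepFun X Z P
  indep_ξ : IndepFun (fun ω => (X ω, Z ω)) ξ P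
  indep_Z' : IndepFun (fun ω => (X ω, Z ω, ξ ω)) Z' P
  indep_ξ' : IndepFun (fun ω => (X ω, Z ω, ξ ω, Z' ω)) ξ' P
  copy_Z : IdentDistrib Z' Z P P
  copy_ξ : IdentDistrib ξ' ξ P P

/-- The sequence `(Xs i, Zs i, ξs i, Zs' i, ξs' i)` is an i.i.d. sample of the law of
`(X, Z, ξ, Z', ξ')`. -/
structure IsSample {Ω 𝓧 𝓩 Ξ : Type*} [MeasurableSpace Ω] [MeasurableSpace 𝓧] [MeasurableSpace 𝓩]
    [MeasurableSpace Ξ] (P : Measure Ω) (X : Ω → 𝓧) (Z : Ω → 𝓩) (ξ : Ω → Ξ) (Z' : Ω → 𝓩)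
    (ξ' : Ω → Ξ) (Xs : ℕ → Ω → 𝓧) (Zs : ℕ → Ω → 𝓩) (ξs : ℕ → Ω → Ξ) (Zs' : ℕ → Ω → 𝓩)
    (ξs' : ℕ → Ω → Ξ) : Prop where
  measurable_X : ∀ i, Measurable (Xs i)
  measurable_Z : ∀ i, Measurable (Zs i)
  measurable_ξ : ∀ i, Measurable (ξs i)
  measurable_Z' : ∀ i, Measurable (Zs' i)
  measurable_ξ' : ∀ i, Measurable (ξs' i)
  indep : iIndepFun (fun i ω => (Xs i ω, Zs i ω, ξs i ω, Zs' i ω, ξs' i ω)) P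
  identDistrib : ∀ i, IdentDistrib (fun ω => (Xs i ω, Zs i ω, ξs i ω, Zs' i ω, ξs' i ω))
    (fun ω => (X ω, Z ω, ξ ω, Z' ω, ξ' ω)) P P

/-- The perturbed model `f + δ`, a function of the inputs and of the additional randomness. -/
def metamodel {𝓧 𝓩 Ξ : Type*} (f : 𝓧 → 𝓩 → ℝ) (δ : 𝓧 → 𝓩 → Ξ → ℝ) (x : 𝓧) (z : 𝓩) (e : Ξ) : ℝ :=
  f x z + δ x z e

/-- The Sobol index `Var(E(Y|X)) / Var(Y)`. -/
def sobolIndex {Ω 𝓧 : Type*} [MeasurableSpace Ω] [m𝓧 : MeasurableSpace 𝓧] (P : Measure Ω)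
    (X : Ω → 𝓧) (Y : Ω → ℝ) : ℝ :=
  Var[P[Y | m𝓧.comap X]; P] / Var[Y; P]

/-- The correlation coefficient (equal to `0` if one of the variances vanishes). -/
def corr {Ω : Type*} [MeasurableSpace Ω] (P : Measure Ω) (A B : Ω → ℝ) : ℝ :=
  cov[A, B; P] / √(Var[A; P] * Var[B; P])

/-- The quantity `C_δ` built from `Y`, `Y^X`, `δ` and `δ^X`. -/
def correlationQuantity {Ω : Type*} [MeasurableSpace Ω] (P : Measure Ω)
    (Y YX δ δX : Ω → ℝ) : ℝ :=
  2 * √(Var[Y; P]) * (corr P Y δX - corr P Y YX * corr P Y δ)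
    + √(Var[δ; P]) * (corr P δ δX - corr P Y YX)

/-- The first pick-freeze estimator, evaluated at the data `y i`, `yX i`, `i < N`. -/
def estimatorS (N : ℕ) (y yX : ℕ → ℝ) : ℝ :=
  ((1 / N : ℝ) * ∑ i ∈ Finset.range N, y i * yX i
      - ((1 / N : ℝ) * ∑ i ∈ Finset.range N, y i) * ((1 / N : ℝ) * ∑ i ∈ Finset.range N, yX i))
    / ((1 / N : ℝ) * ∑ i ∈ Finset.range N, y i ^ 2
      - ((1 / N : ℝ) * ∑ i ∈ Finset.range N, y i) ^ 2)

/-- The second pick-freeze estimator, evaluated at the data `y i`, `yX i`, `i < N`. -/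
def estimatorT (N : ℕ) (y yX : ℕ → ℝ) : ℝ :=
  ((1 / N : ℝ) * ∑ i ∈ Finset.range N, y i * yX i
      - ((1 / N : ℝ) * ∑ i ∈ Finset.range N, (y i + yX i) / 2) ^ 2)
    / ((1 / N : ℝ) * ∑ i ∈ Finset.range N, (y i ^ 2 + yX i ^ 2) / 2
      - ((1 / N : ℝ) * ∑ i ∈ Finset.range N, (y i + yX i) / 2) ^ 2)

/-- The asymptotic variance `σ_S²`, with `S` the Sobol index. -/
def asympVarS {Ω : Type*} [MeasurableSpace Ω] (P : Measure Ω) (Y YX : Ω → ℝ) (S : ℝ) : ℝ :=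
  Var[fun ω => (Y ω - P[Y]) * ((YX ω - P[Y]) - S * (Y ω - P[Y])); P] / Var[Y; P] ^ 2

/-- The asymptotic variance `σ_T²`, with `S` the Sobol index. -/
def asympVarT {Ω : Type*} [MeasurableSpace Ω] (P : Measure Ω) (Y YX : Ω → ℝ) (S : ℝ) : ℝ :=
  Var[fun ω => (Y ω - P[Y]) * (YX ω - P[Y])
      - S / 2 * ((Y ω - P[Y]) ^ 2 + (YX ω - P[Y]) ^ 2); P] / Var[Y; P] ^ 2

/-- `σ_S²` is nonnegative, so that it can serve as the variance of a Gaussian law. -/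
theorem asympVarS_nonneg {Ω : Type*} [MeasurableSpace Ω] (P : Measure Ω) (Y YX : Ω → ℝ) (S : ℝ) :
    0 ≤ asympVarS P Y YX S :=
  div_nonneg (variance_nonneg _ _) (sq_nonneg _)

/-- `σ_T²` is nonnegative, so that it can serve as the variance of a Gaussian law. -/
theorem asympVarT_nonneg {Ω : Type*} [MeasurableSpace Ω] (P : Measure Ω) (Y YX : Ω → ℝ) (S : ℝ) :
    0 ≤ asympVarT P Y YX S :=
  div_nonneg (variance_nonneg _ _) (sq_nonneg _)

/-- `√N (E_N - S)` converges in distribution to the Gaussian law with mean `m` and variance `v`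
(a Dirac mass if `v = 0`). -/
def AsympNormal {Ω : Type*} [MeasurableSpace Ω] (P : Measure Ω) [IsProbabilityMeasure P]
    (E : ℕ → Ω → ℝ) (S m : ℝ) (v : ℝ≥0) : Prop :=
  TendstoInDistribution (fun (N : ℕ) ω => √(N : ℝ) * (E N ω - S)) atTop (id : ℝ → ℝ)
    (fun _ => P) (gaussianReal m v)

end

end PickFreeze

open PickFreeze

/-!
The estimators are unchanged when a constant is subtracted from all outputs, so the outputs may be
centred: `a_N = Ỹ_N - 𝔼 Ỹ_N` and `b_N = Ỹ_N^X - 𝔼 Ỹ_N`. Since `Var (δ_N) → 0` and the outputs are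
bounded in `L^{4+s}`, interpolation gives `a_N → Y - 𝔼 Y` in `L^4` (`tendstoLp_four_centred`), and
therefore the products `a_N b_N`, `a_N²` and `b_N²` converge in `L^2`. This makes a Lindeberg
argument unnecessary: a centred sum over a row of the triangular array differs from the
corresponding sum for the limiting i.i.d. sequence by a term of vanishing variance, so the classical
central limit theorem transfers (`tendstoInDistribution_centredSum`).

Both estimators are ratios `(mean u_N - r_N) / (mean q_N - t_N)` with `u_N = a_N b_N`, with
`q_N = a_N²`, respectively `q_N = (a_N² + b_N²) / 2`, and with products of means of centred
variables `r_N, t_N = o(N^{-1/2})`. By Slutsky's theorem (`exists_ratio_decomposition`) the error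
`√N (E_N - S)` behaves like `(G_N + β_N) / Var Y`, where `G_N` is asymptotically
`N(0, Var (u - S q))` and `β_N = √N (𝔼 u_N - S 𝔼 q_N)` is deterministic. The pick-freeze identity
`Cov(Y, Y^X) = Var(𝔼[Y | X])` and the exchangeability of `(Z, ξ)` and `(Z', ξ')` show that
`β_N = √(N Var δ_N) C_{δ,N}` (`covariance_sub_mul_variance_eq`).

The three regimes are those of `β_N`. If `N Var δ_N → 0` then `β_N → 0`, because correlations are
bounded by `1`. If `N Var δ_N` and `C_{δ,N}` converge then `β_N` converges and shifts the limiting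
law. If `N Var δ_N → ∞` then `β_N` is unbounded along the indices with `|C_{δ,N}| ≥ ε`, and a
limiting normal law is impossible: `√N (E_N - S) / β_N` would tend to `0` as well as to `1 / Var Y`
(`not_asympNormal_of_drift_unbounded`).
-/

namespace PickFreeze

/-! ### Convergence in measure and in `L^p` -/

section Convergence

variable {Ω : Type*} [MeasurableSpace Ω] {P : Measure Ω}

theorem tendstoInMeasure_comp_of_continuousAt {ι : Type*} {l : Filter ι} {U V : ι → Ω → ℝ}
    {a b : ℝ} {F : ℝ × ℝ → ℝ} (hF : ContinuousAt F (a, b))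
    (hU : TendstoInMeasure P U l (fun _ => a)) (hV : TendstoInMeasure P V l (fun _ => b)) :
    TendstoInMeasure P (fun i ω => F (U i ω, V i ω)) l (fun _ => F (a, b)) := by
  rw [tendstoInMeasure_iff_dist] at hU hV ⊢
  intro ε hε
  obtain ⟨η, hη, h⟩ := Metric.continuousAt_iff.1 hF ε hε
  have hsum := (hU η hη).add (hV η hη)
  rw [add_zero] at hsum
  refine tendsto_of_tendsto_of_tendsto_of_le_of_le tendsto_const_nhds hsum (fun _ => zero_le)
    fun i => (measure_mono fun ω hω => ?_).trans (measure_union_le _ _)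
  simp only [Set.mem_ofPred_eq, Set.mem_union] at hω ⊢
  by_contra! hcon
  exact absurd (h (x := (U i ω, V i ω)) (by rw [Prod.dist_eq]; exact max_lt hcon.1 hcon.2))
    (not_lt.2 hω)

theorem tendstoInMeasure_const {ι : Type*} {l : Filter ι} {c : ι → ℝ} {a : ℝ}
    (hc : Tendsto c l (𝓝 a)) : TendstoInMeasure P (fun i _ => c i) l (fun _ => a) := by
  rw [tendstoInMeasure_iff_dist]
  intro ε hε
  refine tendsto_const_nhds.congr' ?_
  filter_upwards [Metric.tendsto_nhds.1 hc ε hε] with i hi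
  simp [not_le.2 hi]

theorem tendstoInMeasure_congr_eventually {ι : Type*} {l : Filter ι} {U V : ι → Ω → ℝ}
    {a : Ω → ℝ} (hU : TendstoInMeasure P U l a) (h : ∀ᶠ i in l, U i = V i) :
    TendstoInMeasure P V l a := fun ε hε =>
  (hU ε hε).congr' (h.mono fun i hi => by rw [hi])

/-- `F N → f` in `L^p`, with `F N` in `L^p` from some rank on. -/
structure TendstoLp (P : Measure Ω) (p : ℝ≥0∞) (F : ℕ → Ω → ℝ) (f : Ω → ℝ) : Prop where
  memLp : ∀ᶠ N in atTop, MemLp (F N) p P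
  memLp_lim : MemLp f p P
  tendsto : Tendsto (fun N => eLpNorm (F N - f) p P) atTop (𝓝 0)

namespace TendstoLp

variable {p q r : ℝ≥0∞} {F G : ℕ → Ω → ℝ} {f g : Ω → ℝ}

theorem add (hp : 1 ≤ p) (hF : TendstoLp P p F f) (hG : TendstoLp P p G g) :
    TendstoLp P p (fun N ω => F N ω + G N ω) (fun ω => f ω + g ω) where
  memLp := by filter_upwards [hF.memLp, hG.memLp] with N h₁ h₂ using h₁.add h₂
  memLp_lim := hF.memLp_lim.add hG.memLp_lim
  tendsto := by
    have h := hF.tendsto.add hG.tendsto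
    rw [add_zero] at h
    refine tendsto_of_tendsto_of_tendsto_of_le_of_le' tendsto_const_nhds h
      (Eventually.of_forall fun _ => zero_le) ?_
    filter_upwards [hF.memLp, hG.memLp] with N h₁ h₂
    refine le_trans (le_of_eq (congrArg (eLpNorm · p P) ?_))
      (eLpNorm_add_le (h₁.sub hF.memLp_lim).1 (h₂.sub hG.memLp_lim).1 hp)
    ext ω
    simp only [Pi.sub_apply, Pi.add_apply]
    ring

theorem const_mul (c : ℝ) (hF : TendstoLp P p F f) :
    TendstoLp P p (fun N ω => c * F N ω) (fun ω => c * f ω) where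
  memLp := by filter_upwards [hF.memLp] with N h₁ using h₁.const_mul c
  memLp_lim := hF.memLp_lim.const_mul c
  tendsto := by
    have h := ENNReal.Tendsto.const_mul (a := ‖c‖ₑ) hF.tendsto (Or.inr enorm_ne_top)
    rw [mul_zero] at h
    refine h.congr fun N => ?_
    rw [← eLpNorm_const_smul]
    congr 1
    ext ω
    simp only [Pi.smul_apply, Pi.sub_apply, smul_eq_mul]
    ring

theorem sub (hp : 1 ≤ p) (hF : TendstoLp P p F f) (hG : TendstoLp P p G g) :
    TendstoLp P p (fun N ω => F N ω - G N ω) (fun ω => f ω - g ω) := by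
  simpa [sub_eq_add_neg] using hF.add hp (hG.const_mul (-1))

theorem mono [IsProbabilityMeasure P] (hpq : p ≤ q) (hF : TendstoLp P q F f) :
    TendstoLp P p F f where
  memLp := hF.memLp.mono fun _ h => h.mono_exponent hpq
  memLp_lim := hF.memLp_lim.mono_exponent hpq
  tendsto := by
    refine tendsto_of_tendsto_of_tendsto_of_le_of_le' tendsto_const_nhds hF.tendsto
      (Eventually.of_forall fun _ => zero_le) ?_
    filter_upwards [hF.memLp] with N h
    exact eLpNorm_le_eLpNorm_of_exponent_le hpq (h.sub hF.memLp_lim).1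

/-- Hölder's inequality makes multiplication continuous from `L^p × L^q` to `L^r`. -/
theorem mul [ENNReal.HolderTriple p q r] (hr : 1 ≤ r)
    (hF : TendstoLp P p F f) (hG : TendstoLp P q G g) :
    TendstoLp P r (fun N ω => F N ω * G N ω) (fun ω => f ω * g ω) where
  memLp := by filter_upwards [hF.memLp, hG.memLp] with N h₁ h₂ using h₂.mul h₁
  memLp_lim := hG.memLp_lim.mul hF.memLp_lim
  tendsto := by
    -- `F G - f g = (F - f) (G - g) + (F - f) g + f (G - g)`
    have h1 := ENNReal.Tendsto.mul hF.tendsto (Or.inr ENNReal.zero_ne_top) hG.tendsto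
      (Or.inr ENNReal.zero_ne_top)
    have h2 := ENNReal.Tendsto.mul_const (b := eLpNorm g q P) hF.tendsto
      (Or.inr hG.memLp_lim.2.ne)
    have h3 := ENNReal.Tendsto.const_mul (a := eLpNorm f p P) hG.tendsto
      (Or.inr hF.memLp_lim.2.ne)
    have h := (h1.add h2).add h3
    simp only [mul_zero, zero_mul, add_zero] at h
    refine tendsto_of_tendsto_of_tendsto_of_le_of_le' tendsto_const_nhds h
      (Eventually.of_forall fun _ => zero_le) ?_
    filter_upwards [hF.memLp, hG.memLp] with N h₁ h₂
    have e : (fun ω => F N ω * G N ω) - (fun ω => f ω * g ω)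
        = ((F N - f) • (G N - g) + (F N - f) • g) + f • (G N - g) := by
      ext ω
      simp only [Pi.sub_apply, Pi.add_apply, Pi.mul_apply, smul_eq_mul]
      ring
    have m₁ := h₁.sub hF.memLp_lim
    have m₂ := h₂.sub hG.memLp_lim
    rw [e]
    refine (eLpNorm_add_le ((m₁.1.smul m₂.1).add (m₁.1.smul hG.memLp_lim.1))
      (hF.memLp_lim.1.smul m₂.1) hr).trans ?_
    gcongr
    · refine (eLpNorm_add_le (m₁.1.smul m₂.1) (m₁.1.smul hG.memLp_lim.1) hr).trans ?_
      gcongr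
      · exact eLpNorm_smul_le_mul_eLpNorm m₂.1 m₁.1
      · exact eLpNorm_smul_le_mul_eLpNorm hG.memLp_lim.1 m₁.1
    · exact eLpNorm_smul_le_mul_eLpNorm m₂.1 hF.memLp_lim.1

theorem tendsto_integral (hF : TendstoLp P 1 F f) :
    Tendsto (fun N => ∫ ω, F N ω ∂P) atTop (𝓝 (∫ ω, f ω ∂P)) :=
  tendsto_integral_of_L1' f hF.memLp_lim.1
    (hF.memLp.mono fun _ h => memLp_one_iff_integrable.1 h) hF.tendsto

end TendstoLp

instance holderTriple_four_four_two : ENNReal.HolderTriple 4 4 2 where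
  inv_add_inv_eq_inv := by
    have h4 : (4 : ℝ≥0∞) = 2 * 2 := by norm_num
    rw [h4, ENNReal.mul_inv (by simp) (by simp), ← mul_add, ENNReal.inv_two_add_inv_two, mul_one]

instance holderTriple_two_two_one : ENNReal.HolderTriple 2 2 1 where
  inv_add_inv_eq_inv := by rw [ENNReal.inv_two_add_inv_two, inv_one]

/-- A sequence which tends to `0` in `L^2` and is bounded in `L^{4+s}` tends to `0` in `L^4`:
split at the level `M` in `x^4 ≤ M^2 x^2 + M^{-s} x^{4+s}`. -/
theorem tendsto_eLpNorm_four {F : ℕ → Ω → ℝ} {s : ℝ} (hs : 0 < s) {K : ℝ≥0∞} (hK : K ≠ ∞)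
    (hF : ∀ᶠ N in atTop, AEStronglyMeasurable (F N) P)
    (h2 : Tendsto (fun N => eLpNorm (F N) 2 P) atTop (𝓝 0))
    (hb : ∀ᶠ N in atTop, eLpNorm (F N) (ENNReal.ofReal (4 + s)) P ≤ K) :
    Tendsto (fun N => eLpNorm (F N) 4 P) atTop (𝓝 0) := by
  have key : ∀ M : ℝ, 0 < M → ∀ᶠ N in atTop, ∫⁻ ω, ‖F N ω‖ₑ ^ (4 : ℝ) ∂P
      ≤ ENNReal.ofReal (M ^ 2) * (eLpNorm (F N) 2 P) ^ (2 : ℝ)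
        + ENNReal.ofReal (M ^ (-s)) * K ^ (4 + s) := by
    intro M hM
    filter_upwards [hF, hb] with N hN hbN
    have e2 : (eLpNorm (F N) 2 P) ^ (2 : ℝ) = ∫⁻ ω, ‖F N ω‖ₑ ^ (2 : ℝ) ∂P := by
      rw [eLpNorm_eq_lintegral_rpow_enorm_toReal (by simp) (by simp), ← ENNReal.rpow_mul]
      simp
    have e4 : (eLpNorm (F N) (ENNReal.ofReal (4 + s)) P) ^ (4 + s)
        = ∫⁻ ω, ‖F N ω‖ₑ ^ (4 + s) ∂P := by
      rw [eLpNorm_eq_lintegral_rpow_enorm_toReal (by simp; positivity) (by simp),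
        ← ENNReal.rpow_mul, ENNReal.toReal_ofReal (by positivity),
        one_div_mul_cancel (by positivity), ENNReal.rpow_one]
    rw [e2]
    calc ∫⁻ ω, ‖F N ω‖ₑ ^ (4 : ℝ) ∂P
        ≤ ∫⁻ ω, (ENNReal.ofReal (M ^ 2) * ‖F N ω‖ₑ ^ (2 : ℝ)
          + ENNReal.ofReal (M ^ (-s)) * ‖F N ω‖ₑ ^ (4 + s)) ∂P := by
          refine lintegral_mono fun ω => ?_
          simp only [← ofReal_norm]
          rw [ENNReal.ofReal_rpow_of_nonneg (norm_nonneg _) (by norm_num),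
            ENNReal.ofReal_rpow_of_nonneg (norm_nonneg _) (by norm_num),
            ENNReal.ofReal_rpow_of_nonneg (norm_nonneg _) (by positivity),
            ← ENNReal.ofReal_mul (by positivity), ← ENNReal.ofReal_mul (by positivity),
            ← ENNReal.ofReal_add (by positivity) (by positivity)]
          apply ENNReal.ofReal_le_ofReal
          set x := ‖F N ω‖
          have hx : 0 ≤ x := norm_nonneg _
          have h4' : x ^ (4 : ℝ) = x ^ 2 * x ^ 2 := by
            rw [show (4 : ℝ) = (4 : ℕ) by norm_num, Real.rpow_natCast]; ring
          have h2' : x ^ (2 : ℝ) = x ^ 2 := by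
            rw [show (2 : ℝ) = (2 : ℕ) by norm_num, Real.rpow_natCast]
          rcases le_total x M with h | h
          · have : 0 ≤ M ^ (-s) * x ^ (4 + s) := by positivity
            have : x ^ 2 * x ^ 2 ≤ M ^ 2 * x ^ 2 := by gcongr
            rw [h4', h2']
            linarith
          · have hx' : 0 < x := hM.trans_le h
            have h1 : 1 ≤ M ^ (-s) * x ^ s := by
              rw [Real.rpow_neg hM.le, inv_mul_eq_div, one_le_div (by positivity)]
              exact Real.rpow_le_rpow hM.le h hs.le
            have h5 : x ^ (4 + s) = x ^ (4 : ℝ) * x ^ s := Real.rpow_add hx' _ _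
            have : x ^ (4 : ℝ) * 1 ≤ x ^ (4 : ℝ) * (M ^ (-s) * x ^ s) := by gcongr
            have : 0 ≤ M ^ 2 * x ^ (2 : ℝ) := by positivity
            rw [h5]
            linarith
      _ = ENNReal.ofReal (M ^ 2) * ∫⁻ ω, ‖F N ω‖ₑ ^ (2 : ℝ) ∂P
          + ENNReal.ofReal (M ^ (-s)) * ∫⁻ ω, ‖F N ω‖ₑ ^ (4 + s) ∂P := by
          rw [lintegral_add_left' (by fun_prop), lintegral_const_mul' _ _ (by simp),
            lintegral_const_mul' _ _ (by simp)]
      _ ≤ _ := by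
          rw [← e4]
          gcongr
  have h4 : Tendsto (fun N => ∫⁻ ω, ‖F N ω‖ₑ ^ (4 : ℝ) ∂P) atTop (𝓝 0) := by
    rw [ENNReal.tendsto_nhds_zero]
    intro ε hε
    have hε2 : 0 < ε / 2 := ENNReal.half_pos hε.ne'
    have t1 : Tendsto (fun M : ℝ => ENNReal.ofReal (M ^ (-s)) * K ^ (4 + s)) atTop (𝓝 0) := by
      have := ENNReal.Tendsto.mul_const (b := K ^ (4 + s))
        (ENNReal.tendsto_ofReal (tendsto_rpow_neg_atTop hs))
        (Or.inr (ENNReal.rpow_ne_top_of_nonneg (by positivity) hK))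
      simpa using this
    obtain ⟨M, hM1, hM⟩ := ((ENNReal.tendsto_nhds_zero.1 t1 _ hε2).and
      (eventually_gt_atTop 0)).exists
    have t2 : Tendsto (fun N => ENNReal.ofReal (M ^ 2) * (eLpNorm (F N) 2 P) ^ (2 : ℝ)) atTop
        (𝓝 0) := by
      have := ENNReal.Tendsto.const_mul (a := ENNReal.ofReal (M ^ 2))
        ((ENNReal.continuous_rpow_const (y := 2)).tendsto _ |>.comp h2) (Or.inr (by simp))
      simpa [Function.comp_def] using this
    filter_upwards [key M hM, ENNReal.tendsto_nhds_zero.1 t2 _ hε2] with N h1 h2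
    exact h1.trans ((add_le_add h2 hM1).trans (ENNReal.add_halves ε).le)
  have := (ENNReal.continuous_rpow_const (y := 1 / 4)).tendsto 0 |>.comp h4
  rw [ENNReal.zero_rpow_of_pos (by norm_num)] at this
  refine this.congr fun N => ?_
  rw [eLpNorm_eq_lintegral_rpow_enorm_toReal (by simp) (by simp)]
  simp

end Convergence

/-! ### Limit theorems for triangular arrays `k N (Ws i)`, `i < N` -/

section Arrays

variable {Ω 𝓦 : Type*} [MeasurableSpace Ω] [MeasurableSpace 𝓦] {P : Measure Ω}
  {W : Ω → 𝓦} {Ws : ℕ → Ω → 𝓦}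

/-- `Ws` is a sequence of independent copies of `W`. -/
structure IsIID (P : Measure Ω) (W : Ω → 𝓦) (Ws : ℕ → Ω → 𝓦) : Prop where
  indep : iIndepFun Ws P
  ident : ∀ i, IdentDistrib (Ws i) W P P

/-- The sum of `k N` over the first `N` draws, centred at its mean. -/
noncomputable def centredSum (P : Measure Ω) (W : Ω → 𝓦) (Ws : ℕ → Ω → 𝓦) (k : ℕ → 𝓦 → ℝ) (N : ℕ)
    (ω : Ω) : ℝ :=
  ∑ i ∈ Finset.range N, k N (Ws i ω) - N * ∫ ω', k N (W ω') ∂P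

theorem aemeasurable_centredSum (hW : IsIID P W Ws) {k : ℕ → 𝓦 → ℝ}
    (hk : ∀ N, Measurable (k N)) (N : ℕ) : AEMeasurable (centredSum P W Ws k N) P :=
  (Finset.aemeasurable_fun_sum _ fun i _ =>
    (hk N).comp_aemeasurable (hW.ident i).aemeasurable_fst).sub_const _

variable [IsProbabilityMeasure P]

/-- A rescaled centred sum vanishes in probability as soon as its variance does. -/
theorem tendstoInMeasure_mul_centredSum_zero (hW : IsIID P W Ws) {k : ℕ → 𝓦 → ℝ}
    (hk : ∀ N, Measurable (k N)) (hk2 : ∀ᶠ N in atTop, MemLp (fun ω => k N (W ω)) 2 P)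
    {c : ℕ → ℝ} (hc : Tendsto (fun N => c N ^ 2 * (N * Var[fun ω => k N (W ω); P])) atTop (𝓝 0)) :
    TendstoInMeasure P (fun N ω => c N * centredSum P W Ws k N ω) atTop (fun _ => 0) := by
  rw [tendstoInMeasure_iff_norm]
  intro ε hε
  have h0 : Tendsto (fun N => ENNReal.ofReal
      (c N ^ 2 * (N * Var[fun ω => k N (W ω); P]) / ε ^ 2)) atTop (𝓝 0) := by
    simpa using ENNReal.tendsto_ofReal (hc.div_const (ε ^ 2))
  refine tendsto_of_tendsto_of_tendsto_of_le_of_le' tendsto_const_nhds h0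
    (Eventually.of_forall fun _ => zero_le) ?_
  filter_upwards [hk2] with N hN
  have hid : ∀ i, IdentDistrib (fun ω => k N (Ws i ω)) (fun ω => k N (W ω)) P P :=
    fun i => (hW.ident i).comp (hk N)
  have hL : ∀ i, MemLp (fun ω => k N (Ws i ω)) 2 P := fun i => (hid i).memLp_iff.2 hN
  have hsum : MemLp (fun ω => ∑ i ∈ Finset.range N, k N (Ws i ω)) 2 P :=
    memLp_finsetSum _ fun i _ => hL i
  have hmean : ∫ ω, ∑ i ∈ Finset.range N, k N (Ws i ω) ∂P = N * ∫ ω, k N (W ω) ∂P := by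
    rw [integral_finsetSum _ fun i _ => (hL i).integrable (by norm_num)]
    simp [fun i => (hid i).integral_eq]
  have hvar : Var[fun ω => ∑ i ∈ Finset.range N, k N (Ws i ω); P]
      = N * Var[fun ω => k N (W ω); P] := by
    have := IndepFun.variance_sum (μ := P) (s := Finset.range N)
      (X := fun i ω => k N (Ws i ω)) (fun i _ => hL i)
      (fun i _ j _ hij => (hW.indep.indepFun hij).comp (hk N) (hk N))
    rw [show (fun ω => ∑ i ∈ Finset.range N, k N (Ws i ω))
      = ∑ i ∈ Finset.range N, fun ω => k N (Ws i ω) by ext; simp, this]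
    simp [fun i => (hid i).variance_eq]
  have hT := meas_ge_le_variance_div_sq (hsum.const_mul (c N)) hε
  rw [variance_const_mul, hvar, integral_const_mul, hmean] at hT
  refine le_trans (le_of_eq (congrArg P ?_)) hT
  ext ω
  simp only [centredSum, sub_zero, Real.norm_eq_abs, mul_sub]

theorem variance_le_integral_mul_self {A : Ω → ℝ} (hA : AEStronglyMeasurable A P) :
    Var[A; P] ≤ ∫ ω, A ω * A ω ∂P := by
  have := variance_le_expectation_sq hA
  simpa [sq] using this

/-- Central limit theorem for the rows of a triangular array whose entries converge in `L^2`: the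
array differs from the limiting i.i.d. sequence by a centred sum of vanishing variance. -/
theorem tendstoInDistribution_centredSum (hW : IsIID P W Ws) {h : ℕ → 𝓦 → ℝ} {g : 𝓦 → ℝ}
    (hh : ∀ N, Measurable (h N)) (hg : Measurable g)
    (hL : TendstoLp P 2 (fun N ω => h N (W ω)) (fun ω => g (W ω))) :
    TendstoInDistribution (fun (N : ℕ) ω => (√N)⁻¹ * centredSum P W Ws h N ω) atTop (id : ℝ → ℝ)
      (fun _ => P) (gaussianReal 0 Var[fun ω => g (W ω); P].toNNReal) := by
  have hid : ∀ i, IdentDistrib (fun ω => g (Ws i ω)) (fun ω => g (W ω)) P P :=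
    fun i => (hW.ident i).comp hg
  have hmem : MemLp (fun ω => g (Ws 0 ω)) 2 P := (hid 0).memLp_iff.2 hL.memLp_lim
  have clt := tendstoInDistribution_inv_sqrt_mul_sum_sub (P := P)
    (P' := gaussianReal 0 Var[fun ω => g (W ω); P].toNNReal) (Y := id)
    (X := fun i ω => g (Ws i ω)) (by rw [(hid 0).variance_eq]; exact HasLaw.id) hmem
    (hW.indep.comp (fun _ => g) (fun _ => hg)) (fun i => (hid i).trans (hid 0).symm)
  have hz : TendstoInMeasure P
      (fun (N : ℕ) ω => (√N)⁻¹ * centredSum P W Ws (fun N w => h N w - g w) N ω) atTop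
      (fun _ => 0) := by
    refine tendstoInMeasure_mul_centredSum_zero hW (fun N => (hh N).sub hg)
      (hL.memLp.mono fun N hN => hN.sub hL.memLp_lim) ?_
    have hc : TendstoLp P 2 (fun _ ω => g (W ω)) (fun ω => g (W ω)) :=
      ⟨Eventually.of_forall fun _ => hL.memLp_lim, hL.memLp_lim, by simp⟩
    have hd := hL.sub (by norm_num) hc
    have hi := (hd.mul (r := 1) le_rfl hd).tendsto_integral
    simp only [sub_self, mul_zero, integral_zero] at hi
    refine tendsto_of_tendsto_of_tendsto_of_le_of_le' tendsto_const_nhds hi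
      (Eventually.of_forall fun N => mul_nonneg (sq_nonneg _)
        (mul_nonneg (Nat.cast_nonneg _) (variance_nonneg _ _))) ?_
    filter_upwards [eventually_ge_atTop 1, hd.memLp] with N hN hNd
    have hN' : (0 : ℝ) < N := by exact_mod_cast hN
    rw [inv_pow, Real.sq_sqrt hN'.le, inv_mul_cancel_left₀ hN'.ne']
    exact variance_le_integral_mul_self hNd.1
  refine tendstoInDistribution_of_tendstoInMeasure_sub _ _ clt ?_
    (fun N => (aemeasurable_centredSum hW hh N).const_mul _)
  refine tendstoInMeasure_congr_eventually hz ?_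
  filter_upwards [hL.memLp] with N hN
  ext ω
  simp only [Pi.sub_apply, centredSum, (hid 0).integral_eq]
  rw [integral_sub (hN.integrable (by norm_num)) (hL.memLp_lim.integrable (by norm_num)),
    Finset.sum_sub_distrib]
  ring

/-- Weak law of large numbers for the rows of a triangular array whose entries converge in
`L^1`. -/
theorem tendstoInMeasure_mean (hW : IsIID P W Ws) {h : ℕ → 𝓦 → ℝ} {g : 𝓦 → ℝ}
    (hh : ∀ N, Measurable (h N)) (hg : Measurable g)
    (hL : TendstoLp P 1 (fun N ω => h N (W ω)) (fun ω => g (W ω))) :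
    TendstoInMeasure P (fun (N : ℕ) ω => (1 / N : ℝ) * ∑ i ∈ Finset.range N, h N (Ws i ω)) atTop
      (fun _ => ∫ ω, g (W ω) ∂P) := by
  have hid : ∀ i, IdentDistrib (fun ω => g (Ws i ω)) (fun ω => g (W ω)) P P :=
    fun i => (hW.ident i).comp hg
  have hgi : ∀ i, Integrable (fun ω => g (Ws i ω)) P := fun i =>
    (hid i).integrable_iff.2 (memLp_one_iff_integrable.1 hL.memLp_lim)
  have lln : TendstoInMeasure P (fun (N : ℕ) ω => (1 / N : ℝ) * ∑ i ∈ Finset.range N, g (Ws i ω))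
      atTop (fun _ => ∫ ω, g (W ω) ∂P) := by
    refine tendstoInMeasure_of_tendsto_ae (fun N => ?_) ?_
    · exact ((Finset.aestronglyMeasurable_fun_sum _ fun i _ => (hgi i).1).const_mul _)
    · have := strong_law_ae_real (μ := P) (fun i ω => g (Ws i ω)) (hgi 0)
        (fun i j hij => (hW.indep.indepFun hij).comp hg hg) (fun i => (hid i).trans (hid 0).symm)
      rw [(hid 0).integral_eq] at this
      filter_upwards [this] with ω hω
      simpa [div_eq_inv_mul] using hω
  have hz : TendstoInMeasure P
      (fun (N : ℕ) ω => (1 / N : ℝ) * ∑ i ∈ Finset.range N, (h N (Ws i ω) - g (Ws i ω))) atTop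
      (fun _ => 0) := by
    have hm : ∀ (N i : ℕ), AEStronglyMeasurable (fun ω => h N (Ws i ω) - g (Ws i ω)) P :=
      fun N i => (((hh N).sub hg).comp_aemeasurable
        (hW.ident i).aemeasurable_fst).aestronglyMeasurable
    refine tendstoInMeasure_of_tendsto_eLpNorm (p := 1) one_ne_zero
      (fun N => (Finset.aestronglyMeasurable_fun_sum _ fun i _ => hm N i).const_mul _)
      aestronglyMeasurable_const ?_
    refine tendsto_of_tendsto_of_tendsto_of_le_of_le' tendsto_const_nhds hL.tendsto
      (Eventually.of_forall fun _ => zero_le) ?_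
    filter_upwards [eventually_ge_atTop 1] with N hN
    have hN' : (N : ℝ) ≠ 0 := by positivity
    have e : (fun ω => (1 / N : ℝ) * ∑ i ∈ Finset.range N, (h N (Ws i ω) - g (Ws i ω)))
        - (fun _ => (0 : ℝ))
        = (1 / N : ℝ) • ∑ i ∈ Finset.range N, fun ω => h N (Ws i ω) - g (Ws i ω) := by
      ext ω
      simp
    rw [e, eLpNorm_const_smul]
    calc _ ≤ ‖(1 / N : ℝ)‖ₑ * ∑ i ∈ Finset.range N,
          eLpNorm (fun ω => h N (Ws i ω) - g (Ws i ω)) 1 P := by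
          gcongr
          exact eLpNorm_sum_le (fun i _ => hm N i) le_rfl
      _ = ‖(1 / N : ℝ)‖ₑ * (N * eLpNorm (fun ω => h N (W ω) - g (W ω)) 1 P) := by
          have hE : ∀ i, eLpNorm (fun ω => h N (Ws i ω) - g (Ws i ω)) 1 P
              = eLpNorm (fun ω => h N (W ω) - g (W ω)) 1 P :=
            fun i => ((hW.ident i).comp ((hh N).sub hg)).eLpNorm_eq 1
          simp [hE]
      _ = _ := by
          rw [← mul_assoc]
          have : ‖(1 / N : ℝ)‖ₑ * (N : ℝ≥0∞) = 1 := by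
            have : (N : ℝ≥0∞) = ‖(N : ℝ)‖ₑ := by simp
            rw [this, ← enorm_mul, one_div, inv_mul_cancel₀ hN', enorm_one]
          rw [this, one_mul]
          rfl
  have := tendstoInMeasure_comp_of_continuousAt (F := fun x => x.1 + x.2) (by fun_prop) lln hz
  simp only [add_zero] at this
  refine tendstoInMeasure_congr_eventually this (Eventually.of_forall fun N => ?_)
  ext ω
  rw [Finset.sum_sub_distrib]
  ring

/-- The product of the means of two centred arrays which converge in `L^2` is `o(N^{-1/2})` in
probability: each mean is `o(N^{-1/4})`. -/
theorem tendstoInMeasure_sqrt_mul_mean_mul_mean (hW : IsIID P W Ws) {h k : ℕ → 𝓦 → ℝ}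
    {f g : 𝓦 → ℝ} (hh : ∀ N, Measurable (h N)) (hk : ∀ N, Measurable (k N))
    (hL : TendstoLp P 2 (fun N ω => h N (W ω)) (fun ω => f (W ω)))
    (kL : TendstoLp P 2 (fun N ω => k N (W ω)) (fun ω => g (W ω)))
    (h0 : ∀ᶠ N in atTop, ∫ ω, h N (W ω) ∂P = 0) (k0 : ∀ᶠ N in atTop, ∫ ω, k N (W ω) ∂P = 0) :
    TendstoInMeasure P (fun (N : ℕ) ω => √N * (((1 / N : ℝ) * ∑ i ∈ Finset.range N, h N (Ws i ω))
      * ((1 / N : ℝ) * ∑ i ∈ Finset.range N, k N (Ws i ω)))) atTop (fun _ => 0) := by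
  have aux : ∀ {h : ℕ → 𝓦 → ℝ} {f : 𝓦 → ℝ}, (∀ N, Measurable (h N)) →
      TendstoLp P 2 (fun N ω => h N (W ω)) (fun ω => f (W ω)) →
      (∀ᶠ N in atTop, ∫ ω, h N (W ω) ∂P = 0) →
      TendstoInMeasure P (fun (N : ℕ) ω =>
        √(√N) * ((1 / N : ℝ) * ∑ i ∈ Finset.range N, h N (Ws i ω))) atTop (fun _ => 0) := by
    intro h f hh hL h0
    have hz : TendstoInMeasure P (fun (N : ℕ) ω => (√(√N) * (1 / N)) * centredSum P W Ws h N ω)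
        atTop (fun _ => 0) := by
      refine tendstoInMeasure_mul_centredSum_zero hW hh hL.memLp ?_
      have hi := (hL.mul (r := 1) le_rfl hL).tendsto_integral
      have hs : Tendsto (fun N : ℕ => (√(N : ℝ))⁻¹) atTop (𝓝 0) :=
        tendsto_inv_atTop_zero.comp
          (Real.tendsto_sqrt_atTop.comp tendsto_natCast_atTop_atTop)
      have hp := hs.mul hi
      rw [zero_mul] at hp
      refine tendsto_of_tendsto_of_tendsto_of_le_of_le' tendsto_const_nhds hp
        (Eventually.of_forall fun N => mul_nonneg (sq_nonneg _)
          (mul_nonneg (Nat.cast_nonneg _) (variance_nonneg _ _))) ?_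
      filter_upwards [eventually_ge_atTop 1, hL.memLp] with N hN hNd
      have hN' : (0 : ℝ) < N := by exact_mod_cast hN
      have e : (√(√(N : ℝ)) * (1 / N)) ^ 2 * N = (√(N : ℝ))⁻¹ := by
        have h1 := Real.sq_sqrt hN'.le
        have h2 : 0 < √(N : ℝ) := Real.sqrt_pos.2 hN'
        rw [mul_pow, Real.sq_sqrt h2.le]
        field_simp
        rw [h1]
      rw [← mul_assoc, e]
      gcongr
      exact variance_le_integral_mul_self hNd.1
    refine tendstoInMeasure_congr_eventually hz ?_
    filter_upwards [h0] with N hN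
    ext ω
    rw [centredSum, hN]
    ring
  have := tendstoInMeasure_comp_of_continuousAt (F := fun x => x.1 * x.2) (by fun_prop)
    (aux hh hL h0) (aux hk kL k0)
  simp only [mul_zero] at this
  refine tendstoInMeasure_congr_eventually this (Eventually.of_forall fun N => ?_)
  ext ω
  have h1 := Real.mul_self_sqrt (Real.sqrt_nonneg (N : ℝ))
  linear_combination ((1 / N : ℝ) * ∑ i ∈ Finset.range N, h N (Ws i ω))
    * ((1 / N : ℝ) * ∑ i ∈ Finset.range N, k N (Ws i ω)) * h1

end Arrays

/-! ### Asymptotic normality of a ratio of means with a deterministic drift -/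

section Ratio

variable {Ω : Type*} [MeasurableSpace Ω] {P : Measure Ω} [IsProbabilityMeasure P]

/-- Convergence in distribution depends only on the law of the limit. -/
theorem tendstoInDistribution_congr_law {ι Ω₁ Ω₂ : Type*} [MeasurableSpace Ω₁]
    [MeasurableSpace Ω₂] {μ₁ : Measure Ω₁} {μ₂ : Measure Ω₂} [IsProbabilityMeasure μ₁]
    [IsProbabilityMeasure μ₂] {l : Filter ι} {X : ι → Ω → ℝ} {Z₁ : Ω₁ → ℝ} {Z₂ : Ω₂ → ℝ}
    (h : TendstoInDistribution X l Z₁ (fun _ => P) μ₁) (hZ : AEMeasurable Z₂ μ₂)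
    (hlaw : μ₁.map Z₁ = μ₂.map Z₂) : TendstoInDistribution X l Z₂ (fun _ => P) μ₂ where
  forall_aemeasurable := h.forall_aemeasurable
  aemeasurable_limit := hZ
  tendsto := by
    have h' := h.tendsto
    simp only [hlaw] at h'
    exact h'

theorem gaussianReal_map_affine (m c : ℝ) (v w : ℝ≥0) (hw : (w : ℝ) = v * c ^ 2) :
    (gaussianReal 0 v).map (fun x => (x + m) * c) = (gaussianReal (m * c) w).map id := by
  have h : (fun x : ℝ => (x + m) * c) = (fun x => x * c) ∘ (fun x => x + m) := rfl
  rw [h, ← Measure.map_map (by fun_prop) (by fun_prop), gaussianReal_map_add_const,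
    gaussianReal_map_mul_const, Measure.map_id, zero_add, mul_comm c m]
  congr 1
  ext
  rw [NNReal.coe_mul, hw]
  exact mul_comm _ _

variable {E G Q R : ℕ → Ω → ℝ} {β : ℕ → ℝ} {S c : ℝ} {v : ℝ≥0}

/-- If `√N (E N - S) = (G N + β N) Q N + R N` with `G N` asymptotically normal, `Q N → c` and
`R N → 0` in probability, a convergent drift `β N` shifts the limiting normal law. -/
theorem asympNormal_of_drift_tendsto
    (hE : ∀ N, AEMeasurable (E N) P)
    (hG : TendstoInDistribution G atTop (id : ℝ → ℝ) (fun _ => P) (gaussianReal 0 v))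
    (hQ : TendstoInMeasure P Q atTop (fun _ => c)) (hQm : ∀ N, AEMeasurable (Q N) P)
    (hR : TendstoInMeasure P R atTop (fun _ => 0))
    (hdec : ∀ᶠ N : ℕ in atTop, ∀ ω, √N * (E N ω - S) = (G N ω + β N) * Q N ω + R N ω)
    {b : ℝ} (hβ : Tendsto β atTop (𝓝 b)) {w : ℝ≥0} (hw : (w : ℝ) = v * c ^ 2) :
    AsympNormal P E S (b * c) w := by
  have h1 := hG.add_of_tendstoInMeasure_const (tendstoInMeasure_const hβ)
    (fun _ => aemeasurable_const)
  have h2 := h1.continuous_comp_prodMk_of_tendstoInMeasure_const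
    (g := fun x : ℝ × ℝ => x.1 * x.2) (by fun_prop) hQ hQm
  have h3 := tendstoInDistribution_congr_law h2 (μ₂ := gaussianReal (b * c) w) (Z₂ := id)
    aemeasurable_id (gaussianReal_map_affine b c v w hw)
  refine tendstoInDistribution_of_tendstoInMeasure_sub _ _ h3 ?_
    (fun N => ((hE N).sub_const S).const_mul _)
  refine tendstoInMeasure_congr_eventually hR ?_
  filter_upwards [hdec] with N hN
  ext ω
  simp only [Pi.sub_apply, Pi.add_apply, hN]
  ring

/-- Along a filter on which the drift is unbounded, `√N (E N - S) / β N` would tend both to `0`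
(if `E` were asymptotically normal) and to `c ≠ 0`. -/
theorem not_asympNormal_of_drift_unbounded
    (hE : ∀ N, AEMeasurable (E N) P)
    (hG : TendstoInDistribution G atTop (id : ℝ → ℝ) (fun _ => P) (gaussianReal 0 v))
    (hQ : TendstoInMeasure P Q atTop (fun _ => c)) (hQm : ∀ N, AEMeasurable (Q N) P)
    (hR : TendstoInMeasure P R atTop (fun _ => 0))
    (hdec : ∀ᶠ N : ℕ in atTop, ∀ ω, √N * (E N ω - S) = (G N ω + β N) * Q N ω + R N ω)
    (hc : c ≠ 0) {l : Filter ℕ} [l.NeBot] [l.IsCountablyGenerated] (hl : l ≤ atTop)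
    (hβ : Tendsto (fun N => |β N|) l atTop) (m : ℝ) (w : ℝ≥0) : ¬ AsympNormal P E S m w := by
  intro hcon
  have hinv : Tendsto (fun N => (β N)⁻¹) l (𝓝 0) := by
    refine (tendsto_zero_iff_abs_tendsto_zero _).2 ?_
    simpa [Function.comp_def, abs_inv] using tendsto_inv_atTop_zero.comp hβ
  have hcon' : TendstoInDistribution (fun (N : ℕ) ω => √(N : ℝ) * (E N ω - S)) l (id : ℝ → ℝ)
      (fun _ => P) (gaussianReal m w) :=
    ⟨hcon.forall_aemeasurable, hcon.aemeasurable_limit, hcon.tendsto.mono_left hl⟩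
  have hG' : TendstoInDistribution G l (id : ℝ → ℝ) (fun _ => P) (gaussianReal 0 v) :=
    ⟨hG.forall_aemeasurable, hG.aemeasurable_limit, hG.tendsto.mono_left hl⟩
  have h1 := hcon'.continuous_comp_prodMk_of_tendstoInMeasure_const
    (g := fun x : ℝ × ℝ => x.1 * x.2) (by fun_prop) (tendstoInMeasure_const hinv)
    (fun _ => aemeasurable_const)
  have hQ0 := tendstoInMeasure_comp_of_continuousAt (F := fun x => x.1 * x.2) (by fun_prop)
    (tendstoInMeasure_const (P := P) hinv) (hQ.mono hl)
  simp only [zero_mul] at hQ0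
  have h2 := (hG'.continuous_comp_prodMk_of_tendstoInMeasure_const
    (g := fun x : ℝ × ℝ => x.1 * x.2) (by fun_prop) hQ0
    (fun N => (hQm N).const_mul _)).add_of_tendstoInMeasure_const (hQ.mono hl) hQm
  have hR0 := tendstoInMeasure_comp_of_continuousAt (F := fun x => x.1 * x.2) (by fun_prop)
    (hR.mono hl) (tendstoInMeasure_const (P := P) hinv)
  simp only [zero_mul] at hR0
  have h3 := tendstoInDistribution_of_tendstoInMeasure_sub
    (fun (N : ℕ) ω => √(N : ℝ) * (E N ω - S) * (β N)⁻¹) _ h2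
    (by
      refine tendstoInMeasure_congr_eventually hR0 ?_
      filter_upwards [hl hdec, hβ.eventually_gt_atTop 0] with N hN hb
      ext ω
      have hb' : β N ≠ 0 := abs_pos.1 hb
      simp only [Pi.sub_apply, Pi.add_apply, hN]
      field_simp
      ring)
    (fun N => (((hE N).sub_const S).const_mul _).mul_const _)
  have hu := tendstoInDistribution_unique _ h1 h3
  simp only [id, mul_zero, zero_add, Measure.map_const, measure_univ, one_smul] at hu
  exact hc (dirac_eq_dirac_iff.1 hu).symm

end Ratio

section RatioOfMeans

variable {Ω 𝓦 : Type*} [MeasurableSpace Ω] [MeasurableSpace 𝓦] {P : Measure Ω}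
  [IsProbabilityMeasure P] {W : Ω → 𝓦} {Ws : ℕ → Ω → 𝓦}

/-- Delta method for a ratio of means: `√N (E N - S)` is an asymptotically normal sequence plus
the drift `√N (𝔼 u_N - S 𝔼 q_N)`, up to a factor tending to `1 / 𝔼 q` and a remainder. The
remainder accounts for the event that the denominator vanishes. -/
theorem exists_ratio_decomposition (hW : IsIID P W Ws) {u q : ℕ → 𝓦 → ℝ} {u' q' : 𝓦 → ℝ}
    (hu : ∀ N, Measurable (u N)) (hq : ∀ N, Measurable (q N)) (hu' : Measurable u')
    (hq' : Measurable q')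
    (uL : TendstoLp P 2 (fun N ω => u N (W ω)) (fun ω => u' (W ω)))
    (qL : TendstoLp P 2 (fun N ω => q N (W ω)) (fun ω => q' (W ω)))
    {r t : ℕ → Ω → ℝ} (hr : ∀ N, AEMeasurable (r N) P) (ht : ∀ N, AEMeasurable (t N) P)
    (r0 : TendstoInMeasure P (fun (N : ℕ) ω => √N * r N ω) atTop (fun _ => 0))
    (t0 : TendstoInMeasure P (fun (N : ℕ) ω => √N * t N ω) atTop (fun _ => 0))
    (hq0 : ∫ ω, q' (W ω) ∂P ≠ 0) {S : ℝ} {E : ℕ → Ω → ℝ}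
    (hE : ∀ᶠ N : ℕ in atTop, ∀ ω, E N ω =
      ((1 / N : ℝ) * ∑ i ∈ Finset.range N, u N (Ws i ω) - r N ω)
        / ((1 / N : ℝ) * ∑ i ∈ Finset.range N, q N (Ws i ω) - t N ω)) :
    ∃ G Q R : ℕ → Ω → ℝ,
      TendstoInDistribution G atTop (id : ℝ → ℝ) (fun _ => P)
        (gaussianReal 0 Var[fun ω => u' (W ω) - S * q' (W ω); P].toNNReal) ∧
      TendstoInMeasure P Q atTop (fun _ => (∫ ω, q' (W ω) ∂P)⁻¹) ∧
      (∀ N, AEMeasurable (Q N) P) ∧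
      TendstoInMeasure P R atTop (fun _ => 0) ∧
      ∀ᶠ N : ℕ in atTop, ∀ ω, √N * (E N ω - S) =
        (G N ω + √N * (∫ ω, u N (W ω) ∂P - S * ∫ ω, q N (W ω) ∂P)) * Q N ω + R N ω := by
  classical
  set h : ℕ → 𝓦 → ℝ := fun N w => u N w - S * q N w with hh_def
  set den : ℕ → Ω → ℝ :=
    fun N ω => (1 / N : ℝ) * ∑ i ∈ Finset.range N, q N (Ws i ω) - t N ω with hden_def
  have hh : ∀ N, Measurable (h N) := fun N => (hu N).sub ((hq N).const_mul S)
  have hden : ∀ N, AEMeasurable (den N) P := fun N =>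
    ((Finset.aemeasurable_fun_sum _ fun i _ =>
      (hq N).comp_aemeasurable (hW.ident i).aemeasurable_fst).const_mul _).sub (ht N)
  have hL : TendstoLp P 2 (fun N ω => h N (W ω)) (fun ω => u' (W ω) - S * q' (W ω)) :=
    uL.sub (by norm_num) (qL.const_mul S)
  have clt := tendstoInDistribution_centredSum hW hh (g := fun w => u' w - S * q' w)
    (hu'.sub (hq'.const_mul S)) hL
  have hrt : TendstoInMeasure P (fun (N : ℕ) ω => S * (√N * t N ω) - √N * r N ω) atTop
      (fun _ => 0) := by
    have := tendstoInMeasure_comp_of_continuousAt (F := fun x => S * x.1 - x.2) (by fun_prop)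
      t0 r0
    simpa using this
  have hdenlim : TendstoInMeasure P den atTop (fun _ => ∫ ω, q' (W ω) ∂P) := by
    have ht' : TendstoInMeasure P t atTop (fun _ => 0) := by
      have hs : Tendsto (fun N : ℕ => (√(N : ℝ))⁻¹) atTop (𝓝 0) :=
        tendsto_inv_atTop_zero.comp
          (Real.tendsto_sqrt_atTop.comp tendsto_natCast_atTop_atTop)
      have := tendstoInMeasure_comp_of_continuousAt (F := fun x => x.1 * x.2) (by fun_prop)
        (tendstoInMeasure_const (P := P) hs) t0
      simp only [mul_zero] at this
      refine tendstoInMeasure_congr_eventually this ?_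
      filter_upwards [eventually_ge_atTop 1] with N hN
      have hN' : 0 < √(N : ℝ) := Real.sqrt_pos.2 (by exact_mod_cast hN)
      ext ω
      exact inv_mul_cancel_left₀ hN'.ne' _
    have := tendstoInMeasure_comp_of_continuousAt (F := fun x => x.1 - x.2) (by fun_prop)
      (tendstoInMeasure_mean hW hq hq' (qL.mono (by norm_num))) ht'
    simpa only [sub_zero] using this
  -- the convention `x / 0 = 0` makes `E N ω = 0` when `den N ω = 0`
  refine ⟨fun N ω => (√N)⁻¹ * centredSum P W Ws h N ω + (S * (√N * t N ω) - √N * r N ω),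
    fun N ω => (den N ω)⁻¹, fun N ω => if den N ω = 0 then √N * (0 - S) else 0, ?_, ?_,
    fun N => (hden N).inv, ?_, ?_⟩
  · have := clt.add_of_tendstoInMeasure_const hrt
      (fun N => (((ht N).const_mul _).const_mul _).sub ((hr N).const_mul _))
    simp only [add_zero] at this
    exact this
  · exact tendstoInMeasure_comp_of_continuousAt (F := fun x => x.1⁻¹)
      ((continuousAt_inv₀ hq0).comp (x := (_, _)) continuousAt_fst) hdenlim hdenlim
  · intro ε hε
    rw [tendstoInMeasure_iff_dist] at hdenlim
    refine tendsto_of_tendsto_of_tendsto_of_le_of_le tendsto_const_nhds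
      (hdenlim _ (abs_pos.2 hq0)) (fun _ => zero_le) fun N => measure_mono fun ω hω => ?_
    simp only [Set.mem_ofPred_eq] at hω ⊢
    by_cases hd : den N ω = 0
    · simp [hd, Real.dist_eq]
    · simp only [hd, if_false, edist_self] at hω
      exact absurd hε (not_lt.2 hω)
  · filter_upwards [hE, eventually_ge_atTop 1, uL.memLp, qL.memLp] with N hN hN1 hu2 hq2 ω
    have hs : 0 < √(N : ℝ) := Real.sqrt_pos.2 (by exact_mod_cast hN1)
    have hs2 : √(N : ℝ) * √N = N := Real.mul_self_sqrt (Nat.cast_nonneg _)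
    have hint : ∫ ω, h N (W ω) ∂P = ∫ ω, u N (W ω) ∂P - S * ∫ ω, q N (W ω) ∂P := by
      rw [← integral_const_mul, ← integral_sub (hu2.integrable (by norm_num))
        ((hq2.integrable (by norm_num)).const_mul S)]
    rw [hN ω]
    change √(N : ℝ) * (_ / den N ω - S) = _
    by_cases hd : den N ω = 0
    · simp [hd]
    · simp only [hd, if_false, add_zero, centredSum, hint]
      have hsum : ∑ i ∈ Finset.range N, h N (Ws i ω) = ∑ i ∈ Finset.range N, u N (Ws i ω)
          - S * ∑ i ∈ Finset.range N, q N (Ws i ω) := by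
        rw [Finset.mul_sum, ← Finset.sum_sub_distrib]
      rw [hsum]
      have hdd : den N ω = (1 / N : ℝ) * ∑ i ∈ Finset.range N, q N (Ws i ω) - t N ω := rfl
      generalize ∑ i ∈ Finset.range N, u N (Ws i ω) = A at *
      generalize ∑ i ∈ Finset.range N, q N (Ws i ω) = B at *
      generalize ∫ ω, u N (W ω) ∂P = a at *
      generalize ∫ ω, q N (W ω) ∂P = b at *
      generalize den N ω = d at *
      generalize √(N : ℝ) = s at *
      rw [← hs2] at hdd ⊢
      field_simp
      field_simp at hdd
      linear_combination (-S) * hdd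

end RatioOfMeans

/-! ### Covariances and correlations -/

section Correlation

variable {Ω : Type*} [MeasurableSpace Ω] {P : Measure Ω} [IsProbabilityMeasure P] {A B : Ω → ℝ}

theorem covariance_sq_le (hA : MemLp A 2 P) (hB : MemLp B 2 P) :
    cov[A, B; P] ^ 2 ≤ Var[A; P] * Var[B; P] := by
  -- the variance of `A + t B` is a nonnegative quadratic polynomial in `t`
  have h : ∀ t : ℝ, 0 ≤ Var[B; P] * (t * t) + 2 * cov[A, B; P] * t + Var[A; P] := by
    intro t
    have h1 := variance_nonneg (A + fun ω => t * B ω) P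
    rw [variance_add hA (hB.const_mul t), variance_const_mul, covariance_const_mul_right] at h1
    linarith
  have := discrim_le_zero h
  rw [discrim] at this
  linarith

/-- This also holds when a variance vanishes, where the correlation is set to `0`: the covariance
is then `0` as well. -/
theorem sqrt_mul_corr (hA : MemLp A 2 P) (hB : MemLp B 2 P) :
    √(Var[A; P]) * √(Var[B; P]) * corr P A B = cov[A, B; P] := by
  have hcs := covariance_sq_le hA hB
  rw [corr, ← Real.sqrt_mul (variance_nonneg _ _)]
  rcases (mul_nonneg (variance_nonneg A P) (variance_nonneg B P)).eq_or_lt with h | h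
  · rw [← h] at hcs ⊢
    rw [Real.sqrt_zero, zero_mul, (pow_eq_zero_iff two_ne_zero).1 (hcs.antisymm (sq_nonneg _))]
  · rw [mul_div_cancel₀ _ (Real.sqrt_pos.2 h).ne']

theorem abs_corr_le_one (hA : MemLp A 2 P) (hB : MemLp B 2 P) : |corr P A B| ≤ 1 := by
  rw [corr, abs_div, abs_of_nonneg (Real.sqrt_nonneg _)]
  exact div_le_one_of_le₀ (Real.abs_le_sqrt (covariance_sq_le hA hB)) (Real.sqrt_nonneg _)

/-- The bias identity: for the perturbed pair `(Y + D, Y^X + D^X)` the quantity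
`Cov - S Var`, which is zero without perturbation, equals `√(Var D)` times `C_δ`. -/
theorem covariance_sub_mul_variance_eq {Y YX D DX : Ω → ℝ} {S : ℝ} (hY : MemLp Y 2 P)
    (hYX : MemLp YX 2 P) (hD : MemLp D 2 P) (hDX : MemLp DX 2 P) (hY0 : Var[Y; P] ≠ 0)
    (vY : Var[YX; P] = Var[Y; P]) (vD : Var[DX; P] = Var[D; P])
    (hex : cov[D, YX; P] = cov[Y, DX; P]) (hS : cov[Y, YX; P] = S * Var[Y; P]) :
    cov[Y + D, YX + DX; P] - S * Var[Y + D; P]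
      = √(Var[D; P]) * correlationQuantity P Y YX D DX := by
  have e1 := sqrt_mul_corr hY hDX
  have e2 := sqrt_mul_corr hY hD
  have e3 := sqrt_mul_corr hD hDX
  have e4 := sqrt_mul_corr hY hYX
  rw [vD] at e1 e3
  rw [vY, hS, Real.mul_self_sqrt (variance_nonneg _ _), mul_comm] at e4
  have e4' : corr P Y YX = S := mul_right_cancel₀ hY0 e4
  have e5 := Real.mul_self_sqrt (variance_nonneg D P)
  rw [e5] at e3
  rw [covariance_add_left hY hD (hYX.add hDX), covariance_add_right hY hYX hDX,
    covariance_add_right hD hYX hDX, variance_add hY hD, correlationQuantity, hex, hS, e4',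
    ← e1, ← e2, ← e3]
  linear_combination (S - corr P D DX) * e5

theorem abs_correlationQuantity_le {Y YX D DX : Ω → ℝ} (hY : MemLp Y 2 P)
    (hYX : MemLp YX 2 P) (hD : MemLp D 2 P) (hDX : MemLp DX 2 P) :
    |correlationQuantity P Y YX D DX| ≤ 4 * √(Var[Y; P]) + 2 * √(Var[D; P]) := by
  have h1 := abs_corr_le_one hY hDX
  have h2 := abs_corr_le_one hY hYX
  have h3 := abs_corr_le_one hY hD
  have h4 := abs_corr_le_one hD hDX
  have h5 : |corr P Y YX * corr P Y D| ≤ 1 := by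
    rw [abs_mul]; exact mul_le_one₀ h2 (abs_nonneg _) h3
  have h6 : |corr P Y DX - corr P Y YX * corr P Y D| ≤ 2 := (abs_sub _ _).trans (by linarith)
  have h7 : |corr P D DX - corr P Y YX| ≤ 2 := (abs_sub _ _).trans (by linarith)
  rw [correlationQuantity]
  refine (abs_add_le _ _).trans ?_
  rw [abs_mul, abs_mul, abs_mul, abs_two, abs_of_nonneg (Real.sqrt_nonneg _),
    abs_of_nonneg (Real.sqrt_nonneg _)]
  have := mul_le_mul_of_nonneg_left h6 (Real.sqrt_nonneg Var[Y; P])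
  have := mul_le_mul_of_nonneg_left h7 (Real.sqrt_nonneg Var[D; P])
  linarith

end Correlation

/-! ### The law of a pick-freeze draw -/

section Draw

variable {Ω 𝓧 𝓩 Ξ : Type*} [MeasurableSpace Ω] [m𝓧 : MeasurableSpace 𝓧] [MeasurableSpace 𝓩]
  [MeasurableSpace Ξ] {P : Measure Ω} [IsProbabilityMeasure P] {X : Ω → 𝓧} {Z : Ω → 𝓩}
  {ξ : Ω → Ξ} {Z' : Ω → 𝓩} {ξ' : Ω → Ξ}

theorem IsDraw.map_eq_prod (h : IsDraw P X Z ξ Z' ξ') :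
    P.map (fun ω => (X ω, (Z ω, ξ ω), (Z' ω, ξ' ω)))
      = (P.map X).prod (((P.map Z).prod (P.map ξ)).prod ((P.map Z).prod (P.map ξ))) := by
  have mX := h.measurable_X
  have mZ := h.measurable_Z
  have mξ := h.measurable_ξ
  have mZ' := h.measurable_Z'
  have mξ' := h.measurable_ξ'
  have hZ := (indepFun_iff_map_prod_eq_prod_map_map (by fun_prop) (by fun_prop)).1 h.indep_Z
  have hξ := (indepFun_iff_map_prod_eq_prod_map_map (by fun_prop) (by fun_prop)).1 h.indep_ξ
  have hZ' := (indepFun_iff_map_prod_eq_prod_map_map (by fun_prop) (by fun_prop)).1 h.indep_Z'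
  have hξ' := (indepFun_iff_map_prod_eq_prod_map_map (by fun_prop) (by fun_prop)).1
    (h.indep_ξ'.comp (φ := fun p : 𝓧 × 𝓩 × Ξ × 𝓩 => ((p.1, p.2.1, p.2.2.1), p.2.2.2))
      (ψ := id) (by fun_prop) measurable_id)
  have : IsProbabilityMeasure (P.map X) := Measure.isProbabilityMeasure_map mX.aemeasurable
  have : IsProbabilityMeasure (P.map Z) := Measure.isProbabilityMeasure_map mZ.aemeasurable
  have : IsProbabilityMeasure (P.map ξ) := Measure.isProbabilityMeasure_map mξ.aemeasurable
  have e1 : P.map (fun ω => (X ω, Z ω, ξ ω))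
      = (P.map X).prod ((P.map Z).prod (P.map ξ)) := by
    rw [← Measure.prodAssoc_prod, ← hZ, ← hξ, Measure.map_map (by fun_prop) (by fun_prop)]
    rfl
  simp only [Function.comp_def, id] at hξ'
  rw [hZ', e1, h.copy_Z.map_eq, h.copy_ξ.map_eq] at hξ'
  rw [← Measure.prodAssoc_prod, ← Measure.prodAssoc_prod (ν := P.map Z), ← hξ',
    Measure.map_map (by fun_prop) (by fun_prop), Measure.map_map (by fun_prop) (by fun_prop)]
  rfl

/-- The pairs `(Z, ξ)` and `(Z', ξ')` are exchangeable given `X`. -/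
theorem IsDraw.identDistrib_swap (h : IsDraw P X Z ξ Z' ξ') :
    IdentDistrib (fun ω => (X ω, (Z ω, ξ ω), (Z' ω, ξ' ω)))
      (fun ω => (X ω, (Z' ω, ξ' ω), (Z ω, ξ ω))) P P := by
  have mX := h.measurable_X
  have mZ := h.measurable_Z
  have mξ := h.measurable_ξ
  have mZ' := h.measurable_Z'
  have mξ' := h.measurable_ξ'
  refine ⟨by fun_prop, by fun_prop, ?_⟩
  have e : (fun ω => (X ω, (Z' ω, ξ' ω), (Z ω, ξ ω)))
      = Prod.map id Prod.swap ∘ fun ω => (X ω, (Z ω, ξ ω), (Z' ω, ξ' ω)) := rfl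
  have : IsProbabilityMeasure (P.map X) := Measure.isProbabilityMeasure_map mX.aemeasurable
  have : IsProbabilityMeasure (P.map Z) := Measure.isProbabilityMeasure_map mZ.aemeasurable
  have : IsProbabilityMeasure (P.map ξ) := Measure.isProbabilityMeasure_map mξ.aemeasurable
  rw [e, ← Measure.map_map (by fun_prop) (by fun_prop), h.map_eq_prod,
    ← Measure.map_prod_map _ _ measurable_id measurable_swap, Measure.map_id, Measure.prod_swap]

/-- `𝔼[f(X, Z) | X]` is obtained by integrating out the independent variable `Z`. -/
theorem condExp_comap_ae_eq (hX : Measurable X) (hZ : Measurable Z) (hXZ : IndepFun X Z P)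
    {f : 𝓧 → 𝓩 → ℝ} (hf : Measurable fun p : 𝓧 × 𝓩 => f p.1 p.2)
    (hint : Integrable (fun ω => f (X ω) (Z ω)) P) :
    P[fun ω => f (X ω) (Z ω) | m𝓧.comap X] =ᵐ[P] fun ω => ∫ z, f (X ω) z ∂(P.map Z) := by
  have : IsProbabilityMeasure (P.map X) := Measure.isProbabilityMeasure_map hX.aemeasurable
  have : IsProbabilityMeasure (P.map Z) := Measure.isProbabilityMeasure_map hZ.aemeasurable
  have hlaw := (indepFun_iff_map_prod_eq_prod_map_map hX.aemeasurable hZ.aemeasurable).1 hXZ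
  have hXZm : Measurable fun ω => (X ω, Z ω) := hX.prodMk hZ
  have hfi : Integrable (fun p : 𝓧 × 𝓩 => f p.1 p.2) ((P.map X).prod (P.map Z)) := by
    rw [← hlaw, integrable_map_measure hf.aestronglyMeasurable hXZm.aemeasurable]
    exact hint
  have hgm : StronglyMeasurable fun x => ∫ z, f x z ∂(P.map Z) :=
    hf.stronglyMeasurable.integral_prod_right
  have hgi : Integrable (fun ω => ∫ z, f (X ω) z ∂(P.map Z)) P :=
    (integrable_map_measure hgm.aestronglyMeasurable hX.aemeasurable).1 hfi.integral_prod_left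
  refine (ae_eq_condExp_of_forall_setIntegral_eq hX.comap_le hint
    (fun s _ _ => hgi.integrableOn) ?_ ?_).symm
  · rintro s ⟨A, hA, rfl⟩ -
    have h1 := setIntegral_map (μ := P) hA hgm.aestronglyMeasurable hX.aemeasurable
    have h2 := setIntegral_map (μ := P) (hA.prod MeasurableSet.univ)
      hf.aestronglyMeasurable hXZm.aemeasurable
    rw [← h1]
    rw [hlaw, setIntegral_prod _ hfi.integrableOn] at h2
    simp only [Measure.restrict_univ] at h2
    rw [h2]
    congr 2
    ext ω
    simp
  · exact (hgm.comp_measurable (comap_measurable X)).aestronglyMeasurable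

/-- The pick-freeze identity `Cov(Y, Y^X) = Var(𝔼[Y | X])`. -/
theorem IsDraw.covariance_eq_variance_condExp (h : IsDraw P X Z ξ Z' ξ')
    {f : 𝓧 → 𝓩 → ℝ} (hf : Measurable fun p : 𝓧 × 𝓩 => f p.1 p.2)
    (hY : MemLp (fun ω => f (X ω) (Z ω)) 2 P) (hYX : MemLp (fun ω => f (X ω) (Z' ω)) 2 P)
    (hmean : ∫ ω, f (X ω) (Z' ω) ∂P = ∫ ω, f (X ω) (Z ω) ∂P) :
    cov[fun ω => f (X ω) (Z ω), fun ω => f (X ω) (Z' ω); P]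
      = Var[P[fun ω => f (X ω) (Z ω) | m𝓧.comap X]; P] := by
  have mX := h.measurable_X
  have mZ := h.measurable_Z
  have mZ' := h.measurable_Z'
  have : IsProbabilityMeasure (P.map X) := Measure.isProbabilityMeasure_map mX.aemeasurable
  have : IsProbabilityMeasure (P.map Z) := Measure.isProbabilityMeasure_map mZ.aemeasurable
  have hZ := (indepFun_iff_map_prod_eq_prod_map_map mX.aemeasurable mZ.aemeasurable).1 h.indep_Z
  have hZ' := (indepFun_iff_map_prod_eq_prod_map_map (by fun_prop) (by fun_prop)).1
    (h.indep_Z'.comp (φ := fun p : 𝓧 × 𝓩 × Ξ => (p.1, p.2.1)) (ψ := id) (by fun_prop)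
      measurable_id)
  simp only [Function.comp_def, id] at hZ'
  rw [hZ, h.copy_Z.map_eq] at hZ'
  have hlaw : P.map (fun ω => (X ω, Z ω, Z' ω))
      = (P.map X).prod ((P.map Z).prod (P.map Z)) := by
    rw [← Measure.prodAssoc_prod, ← hZ', Measure.map_map (by fun_prop) (by fun_prop)]
    rfl
  have hm3 : Measurable fun p : 𝓧 × 𝓩 × 𝓩 => f p.1 p.2.1 * f p.1 p.2.2 :=
    (hf.comp (measurable_fst.prodMk (measurable_fst.comp measurable_snd))).mul
      (hf.comp (measurable_fst.prodMk (measurable_snd.comp measurable_snd)))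
  have hm3' : AEMeasurable (fun ω => (X ω, Z ω, Z' ω)) P := by fun_prop
  have hint : Integrable (fun p : 𝓧 × 𝓩 × 𝓩 => f p.1 p.2.1 * f p.1 p.2.2)
      ((P.map X).prod ((P.map Z).prod (P.map Z))) := by
    rw [← hlaw, integrable_map_measure hm3.aestronglyMeasurable hm3']
    exact hY.integrable_mul hYX
  have hgm : StronglyMeasurable fun x => ∫ z, f x z ∂(P.map Z) :=
    hf.stronglyMeasurable.integral_prod_right
  have hprod : ∫ ω, f (X ω) (Z ω) * f (X ω) (Z' ω) ∂P
      = ∫ ω, (∫ z, f (X ω) z ∂(P.map Z)) ^ 2 ∂P := by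
    have h1 := integral_map (μ := P) hm3' hm3.aestronglyMeasurable
    have h2 := integral_map (μ := P) mX.aemeasurable (hgm.pow 2).aestronglyMeasurable
    rw [hlaw, integral_prod _ hint] at h1
    rw [← h1]
    refine Eq.trans ?_ h2
    congr 1
    ext x
    rw [integral_prod_mul (fun z => f x z) (fun z => f x z)]
    exact (sq _).symm
  have hce := condExp_comap_ae_eq mX mZ h.indep_Z hf (hY.integrable (by norm_num))
  have hL := hY.condExp (m := m𝓧.comap X) (by norm_num)
  rw [covariance_eq_sub hY hYX, variance_eq_sub hL, integral_condExp mX.comap_le, hmean]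
  congr 1
  · refine hprod.trans (integral_congr_ae ?_)
    filter_upwards [hce] with ω hω
    simp [hω]
  · ring

end Draw

/-! ### `L^4` convergence of the centred outputs -/

section Moments

variable {Ω : Type*} [MeasurableSpace Ω] {P : Measure Ω} [IsProbabilityMeasure P]

theorem eLpNorm_sub_integral_le {V : Ω → ℝ} {p : ℝ≥0∞} (hp : 1 ≤ p)
    (hV : AEStronglyMeasurable V P) :
    eLpNorm (fun ω => V ω - ∫ ω', V ω' ∂P) p P ≤ 2 * eLpNorm V p P := by
  have h1 : ‖∫ ω, V ω ∂P‖ₑ ≤ eLpNorm V p P :=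
    (enorm_integral_le_lintegral_enorm V).trans
      (by rw [← eLpNorm_one_eq_lintegral_enorm]; exact eLpNorm_le_eLpNorm_of_exponent_le hp hV)
  have h2 := eLpNorm_sub_le (p := p) hV
    (aestronglyMeasurable_const (b := ∫ ω', V ω' ∂P) (μ := P)) hp
  rw [eLpNorm_const _ (by positivity) (IsProbabilityMeasure.ne_zero P)] at h2
  simp only [measure_univ, ENNReal.one_rpow, mul_one] at h2
  rw [two_mul]
  exact h2.trans (by gcongr)

theorem eLpNorm_two_sub_integral {V : Ω → ℝ} (hV : MemLp V 2 P) :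
    eLpNorm (fun ω => V ω - ∫ ω', V ω' ∂P) 2 P = ENNReal.ofReal √(Var[V; P]) := by
  have h : MemLp (fun ω => V ω - ∫ ω', V ω' ∂P) 2 P := hV.sub (memLp_const _)
  rw [MemLp.eLpNorm_eq_integral_rpow_norm (by simp) (by simp) h,
    variance_eq_integral hV.1.aemeasurable, Real.sqrt_eq_rpow]
  simp

/-- If the outputs `Y + D N` are bounded in `L^{4+s}` and `Var (D N) → 0`, then the centred outputs
converge in `L^4`; in particular `Y` has a finite fourth moment, by Fatou's lemma. -/
theorem tendstoLp_four_centred {Y : Ω → ℝ} {D : ℕ → Ω → ℝ} (hY : MemLp Y 2 P)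
    (hD : ∀ N, AEStronglyMeasurable (D N) P) {s K : ℝ} (hs : 0 < s)
    (hmom : ∀ N, 1 ≤ N → Integrable (fun ω => |Y ω + D N ω| ^ (4 + s)) P ∧
      ∫ ω, |Y ω + D N ω| ^ (4 + s) ∂P < K)
    (hvar : Tendsto (fun N => Var[D N; P]) atTop (𝓝 0)) :
    TendstoLp P 4 (fun N ω => Y ω + D N ω - ∫ ω', (Y ω' + D N ω') ∂P)
      (fun ω => Y ω - ∫ ω', Y ω' ∂P) := by
  set p : ℝ≥0∞ := ENNReal.ofReal (4 + s) with hp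
  have hpr : p.toReal = 4 + s := ENNReal.toReal_ofReal (by positivity)
  have hp4 : 4 ≤ p := by
    rw [show (4 : ℝ≥0∞) = ENNReal.ofReal 4 by norm_num]
    exact ENNReal.ofReal_le_ofReal (by linarith)
  have hp1 : 1 ≤ p := le_trans (by norm_num) hp4
  have hp0 : p ≠ 0 := (zero_lt_one.trans_le hp1).ne'
  have hVm : ∀ N, AEStronglyMeasurable (fun ω => Y ω + D N ω) P := fun N => hY.1.add (hD N)
  have hVp : ∀ N, 1 ≤ N → MemLp (fun ω => Y ω + D N ω) p P := fun N hN => by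
    rw [← integrable_norm_rpow_iff (hVm N) hp0 ENNReal.ofReal_ne_top, hpr]
    exact (hmom N hN).1
  set κ : ℝ≥0∞ := ENNReal.ofReal (K ^ (4 + s)⁻¹)
  have hVκ : ∀ N, 1 ≤ N → eLpNorm (fun ω => Y ω + D N ω) p P ≤ κ := fun N hN => by
    rw [MemLp.eLpNorm_eq_integral_rpow_norm hp0 ENNReal.ofReal_ne_top (hVp N hN), hpr]
    refine ENNReal.ofReal_le_ofReal (Real.rpow_le_rpow ?_ (hmom N hN).2.le (by positivity))
    exact integral_nonneg fun ω => by positivity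
  have hD2 : ∀ N, 1 ≤ N → MemLp (D N) 2 P := fun N hN => by
    have := ((hVp N hN).mono_exponent (le_trans (by norm_num) hp4 : 2 ≤ p)).sub hY
    refine this.ae_eq (Eventually.of_forall fun ω => ?_)
    simp
  set A : ℕ → Ω → ℝ := fun N ω => Y ω + D N ω - ∫ ω', (Y ω' + D N ω') ∂P
  set Yc : Ω → ℝ := fun ω => Y ω - ∫ ω', Y ω' ∂P
  have hAm : ∀ N, AEStronglyMeasurable (A N) P := fun N => (hVm N).sub aestronglyMeasurable_const
  have hYcm : AEStronglyMeasurable Yc P := hY.1.sub aestronglyMeasurable_const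
  have hAκ : ∀ᶠ N in atTop, eLpNorm (A N) p P ≤ 2 * κ := by
    filter_upwards [eventually_ge_atTop 1] with N hN
    refine (eLpNorm_sub_integral_le hp1 (hVm N)).trans ?_
    gcongr
    exact hVκ N hN
  have hdiff : ∀ N, 1 ≤ N → A N - Yc = fun ω => D N ω - ∫ ω', D N ω' ∂P := fun N hN => by
    ext ω
    simp only [A, Yc, Pi.sub_apply]
    rw [integral_add (hY.integrable (by norm_num)) ((hD2 N hN).integrable (by norm_num))]
    ring
  have h2 : Tendsto (fun N => eLpNorm (A N - Yc) 2 P) atTop (𝓝 0) := by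
    have h := ENNReal.tendsto_ofReal ((Real.continuous_sqrt.tendsto 0).comp hvar)
    simp only [Real.sqrt_zero, ENNReal.ofReal_zero] at h
    refine h.congr' ?_
    filter_upwards [eventually_ge_atTop 1] with N hN
    rw [hdiff N hN, eLpNorm_two_sub_integral (hD2 N hN)]
    rfl
  -- the bound in `L^{4+s}` passes to the limit
  have hYκ : eLpNorm Yc p P ≤ 2 * κ := eLpNorm_le_of_tendstoInMeasure hAκ
    (tendstoInMeasure_of_tendsto_eLpNorm (by simp) hAm hYcm h2) hAm
  have hκ : 2 * κ ≠ ∞ := ENNReal.mul_ne_top (by simp) ENNReal.ofReal_ne_top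
  refine ⟨hAκ.mono fun N h => MemLp.mono_exponent ⟨hAm N, h.trans_lt hκ.lt_top⟩ hp4,
    MemLp.mono_exponent ⟨hYcm, hYκ.trans_lt hκ.lt_top⟩ hp4, ?_⟩
  refine tendsto_eLpNorm_four hs (K := 2 * κ + 2 * κ) (by simpa using hκ)
    (Eventually.of_forall fun N => (hAm N).sub hYcm) h2 ?_
  filter_upwards [hAκ] with N hN
  exact (eLpNorm_sub_le (hAm N) hYcm hp1).trans (add_le_add hN hYκ)

end Moments

/-! ### The three regimes of the drift -/

section Regimes

theorem tendsto_drift_of_tendsto {V C : ℕ → ℝ} {v c : ℝ}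
    (hV : Tendsto (fun N : ℕ => (N : ℝ) * V N) atTop (𝓝 v)) (hC : Tendsto C atTop (𝓝 c)) :
    Tendsto (fun N : ℕ => √N * (√(V N) * C N)) atTop (𝓝 (c * √v)) := by
  have h := ((Real.continuous_sqrt.tendsto v).comp hV).mul hC
  rw [mul_comm c]
  refine h.congr fun N => ?_
  simp only [Function.comp_apply]
  rw [Real.sqrt_mul (Nat.cast_nonneg N), mul_assoc]

theorem tendsto_drift_zero {V C : ℕ → ℝ} {B : ℝ}
    (hV : Tendsto (fun N : ℕ => (N : ℝ) * V N) atTop (𝓝 0)) (hC : ∀ᶠ N in atTop, |C N| ≤ B) :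
    Tendsto (fun N : ℕ => √N * (√(V N) * C N)) atTop (𝓝 0) := by
  have h := ((Real.continuous_sqrt.tendsto 0).comp hV).mul_const B
  rw [Real.sqrt_zero, zero_mul] at h
  refine squeeze_zero_norm' ?_ h
  filter_upwards [hC] with N hN
  rw [Function.comp_apply, Real.sqrt_mul (Nat.cast_nonneg N), Real.norm_eq_abs, abs_mul, abs_mul,
    abs_of_nonneg (Real.sqrt_nonneg _), abs_of_nonneg (Real.sqrt_nonneg _), mul_assoc]
  gcongr

theorem tendsto_mul_of_isLittleO {V : ℕ → ℝ} {c : ℝ}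
    (hV : (fun N : ℕ => V N - c / N) =o[atTop] fun N : ℕ => 1 / (N : ℝ)) :
    Tendsto (fun N : ℕ => (N : ℝ) * V N) atTop (𝓝 c) := by
  have h := hV.tendsto_div_nhds_zero.add_const c
  rw [zero_add] at h
  refine h.congr' ?_
  filter_upwards [eventually_ge_atTop 1] with N hN
  have hN' : (N : ℝ) ≠ 0 := by positivity
  field_simp
  ring

/-- If `N V N → ∞` and `C N` does not tend to `0`, then the drift is unbounded along the set of
indices on which `|C N|` stays away from `0`. -/
theorem exists_filter_drift_unbounded {V C : ℕ → ℝ}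
    (hV : Tendsto (fun N : ℕ => (N : ℝ) * V N) atTop atTop) (hC : ¬ Tendsto C atTop (𝓝 0)) :
    ∃ l : Filter ℕ, l.NeBot ∧ l.IsCountablyGenerated ∧ l ≤ atTop ∧
      Tendsto (fun N : ℕ => |√N * (√(V N) * C N)|) l atTop := by
  rw [Metric.tendsto_nhds] at hC
  push Not at hC
  obtain ⟨ε, hε, hfreq⟩ := hC
  refine ⟨atTop ⊓ 𝓟 {N | ε ≤ |C N|}, ?_, inferInstance, inf_le_left, ?_⟩
  · rw [← frequently_mem_iff_neBot]
    exact hfreq.mono fun N hN => by simpa [Real.dist_eq] using hN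
  · have h := ((Real.tendsto_sqrt_atTop.comp hV).atTop_mul_const hε).mono_left
      (inf_le_left : atTop ⊓ 𝓟 {N | ε ≤ |C N|} ≤ atTop)
    refine tendsto_atTop_mono' _ ?_ h
    filter_upwards [mem_inf_of_right (mem_principal_self {N | ε ≤ |C N|})] with N hN
    rw [Function.comp_apply, Real.sqrt_mul (Nat.cast_nonneg N), abs_mul, abs_mul,
      abs_of_nonneg (Real.sqrt_nonneg _), abs_of_nonneg (Real.sqrt_nonneg _), mul_assoc]
    have hN' : ε ≤ |C N| := hN
    gcongr

variable {Ω 𝓦 : Type*} [MeasurableSpace Ω] [MeasurableSpace 𝓦] {P : Measure Ω}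
  [IsProbabilityMeasure P] {W : Ω → 𝓦} {Ws : ℕ → Ω → 𝓦}

/-- The trichotomy for a ratio of means whose drift `𝔼 u_N - S 𝔼 q_N` is `√V_N C_N`. -/
theorem asympNormal_trichotomy (hW : IsIID P W Ws) {u q : ℕ → 𝓦 → ℝ} {u' q' : 𝓦 → ℝ}
    (hu : ∀ N, Measurable (u N)) (hq : ∀ N, Measurable (q N)) (hu' : Measurable u')
    (hq' : Measurable q')
    (uL : TendstoLp P 2 (fun N ω => u N (W ω)) (fun ω => u' (W ω)))
    (qL : TendstoLp P 2 (fun N ω => q N (W ω)) (fun ω => q' (W ω)))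
    {r t : ℕ → Ω → ℝ} (hr : ∀ N, AEMeasurable (r N) P) (ht : ∀ N, AEMeasurable (t N) P)
    (r0 : TendstoInMeasure P (fun (N : ℕ) ω => √N * r N ω) atTop (fun _ => 0))
    (t0 : TendstoInMeasure P (fun (N : ℕ) ω => √N * t N ω) atTop (fun _ => 0))
    {σ : ℝ} (hσ : ∫ ω, q' (W ω) ∂P = σ) (hσ0 : σ ≠ 0) {S : ℝ} {E : ℕ → Ω → ℝ}
    (hEm : ∀ N, AEMeasurable (E N) P)
    (hE : ∀ᶠ N : ℕ in atTop, ∀ ω, E N ω =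
      ((1 / N : ℝ) * ∑ i ∈ Finset.range N, u N (Ws i ω) - r N ω)
        / ((1 / N : ℝ) * ∑ i ∈ Finset.range N, q N (Ws i ω) - t N ω))
    {V C : ℕ → ℝ} {B : ℝ} (hCB : ∀ᶠ N in atTop, |C N| ≤ B) (hC : ¬ Tendsto C atTop (𝓝 0))
    (hdrift : ∀ᶠ N in atTop,
      ∫ ω, u N (W ω) ∂P - S * ∫ ω, q N (W ω) ∂P = √(V N) * C N)
    {w : ℝ≥0} (hw : (w : ℝ) = Var[fun ω => u' (W ω) - S * q' (W ω); P] / σ ^ 2) :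
    (V =o[atTop] (fun N : ℕ => 1 / (N : ℝ)) → AsympNormal P E S 0 w) ∧
    (Tendsto (fun N : ℕ => (N : ℝ) * V N) atTop atTop →
      ∀ (m : ℝ) (v : ℝ≥0), ¬ AsympNormal P E S m v) ∧
    (∀ c γ : ℝ, Tendsto C atTop (𝓝 c) →
      (fun N : ℕ => V N - γ / (c * N)) =o[atTop] (fun N : ℕ => 1 / (N : ℝ)) →
      AsympNormal P E S (c * √(γ / c) / σ) w) := by
  obtain ⟨G, Q, R, hG, hQ, hQm, hR, hdec⟩ :=
    exists_ratio_decomposition hW hu hq hu' hq' uL qL hr ht r0 t0 (hσ ▸ hσ0) (S := S) hE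
  rw [hσ] at hQ
  have hdec' : ∀ᶠ N : ℕ in atTop, ∀ ω,
      √N * (E N ω - S) = (G N ω + √N * (√(V N) * C N)) * Q N ω + R N ω := by
    filter_upwards [hdec, hdrift] with N h1 h2 ω
    rw [h1, h2]
  have hw' : (w : ℝ) =
      (Var[fun ω => u' (W ω) - S * q' (W ω); P].toNNReal : ℝ) * σ⁻¹ ^ 2 := by
    rw [hw, Real.coe_toNNReal _ (variance_nonneg _ _), inv_pow, div_eq_mul_inv]
  refine ⟨fun hV => ?_, fun hV m v => ?_, fun c γ hc hV => ?_⟩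
  · have hV' := tendsto_mul_of_isLittleO (V := V) (c := 0) (by simpa using hV)
    simpa using asympNormal_of_drift_tendsto hEm hG hQ hQm hR hdec'
      (tendsto_drift_zero hV' hCB) hw'
  · obtain ⟨l, hl1, hl2, hl3, hl4⟩ := exists_filter_drift_unbounded hV hC
    exact not_asympNormal_of_drift_unbounded hEm hG hQ hQm hR hdec' (inv_ne_zero hσ0) hl3 hl4 m v
  · have hV' := tendsto_mul_of_isLittleO (V := V) (c := γ / c) (by simpa [div_div] using hV)
    exact asympNormal_of_drift_tendsto hEm hG hQ hQm hR hdec'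
      (tendsto_drift_of_tendsto hV' hc) hw'

end Regimes

/-! ### Translation invariance of the estimators -/

section Estimators

theorem sum_sub_mul_sub (N : ℕ) (y z : ℕ → ℝ) (c : ℝ) :
    ∑ i ∈ Finset.range N, (y i - c) * (z i - c) = ∑ i ∈ Finset.range N, y i * z i
      - c * ∑ i ∈ Finset.range N, y i - c * ∑ i ∈ Finset.range N, z i + N * c ^ 2 := by
  simp only [sub_mul, mul_sub, Finset.sum_sub_distrib, ← Finset.sum_mul, ← Finset.mul_sum,
    Finset.sum_const, Finset.card_range, nsmul_eq_mul]
  ring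

theorem sum_sub_const (N : ℕ) (y : ℕ → ℝ) (c : ℝ) :
    ∑ i ∈ Finset.range N, (y i - c) = ∑ i ∈ Finset.range N, y i - N * c := by
  simp

theorem estimatorS_eq_centred {N : ℕ} (hN : N ≠ 0) (y z : ℕ → ℝ) (c : ℝ) :
    estimatorS N y z =
      ((1 / N : ℝ) * ∑ i ∈ Finset.range N, (y i - c) * (z i - c)
        - ((1 / N : ℝ) * ∑ i ∈ Finset.range N, (y i - c))
          * ((1 / N : ℝ) * ∑ i ∈ Finset.range N, (z i - c)))
      / ((1 / N : ℝ) * ∑ i ∈ Finset.range N, (y i - c) * (y i - c)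
        - ((1 / N : ℝ) * ∑ i ∈ Finset.range N, (y i - c))
          * ((1 / N : ℝ) * ∑ i ∈ Finset.range N, (y i - c))) := by
  have hN' : (N : ℝ) ≠ 0 := Nat.cast_ne_zero.2 hN
  simp only [estimatorS, sum_sub_mul_sub, sum_sub_const, sq]
  congr 1 <;> field_simp <;> ring

theorem estimatorT_eq_centred {N : ℕ} (hN : N ≠ 0) (y z : ℕ → ℝ) (c : ℝ) :
    estimatorT N y z =
      ((1 / N : ℝ) * ∑ i ∈ Finset.range N, (y i - c) * (z i - c)
        - ((1 / N : ℝ) * ∑ i ∈ Finset.range N, 1 / 2 * ((y i - c) + (z i - c)))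
          * ((1 / N : ℝ) * ∑ i ∈ Finset.range N, 1 / 2 * ((y i - c) + (z i - c))))
      / ((1 / N : ℝ) * ∑ i ∈ Finset.range N,
          1 / 2 * ((y i - c) * (y i - c) + (z i - c) * (z i - c))
        - ((1 / N : ℝ) * ∑ i ∈ Finset.range N, 1 / 2 * ((y i - c) + (z i - c)))
          * ((1 / N : ℝ) * ∑ i ∈ Finset.range N, 1 / 2 * ((y i - c) + (z i - c)))) := by
  have hN' : (N : ℝ) ≠ 0 := Nat.cast_ne_zero.2 hN
  simp only [estimatorT, ← Finset.mul_sum, ← Finset.sum_div, Finset.sum_add_distrib,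
    sum_sub_mul_sub, sum_sub_const, sq]
  congr 1 <;> field_simp <;> ring

end Estimators

/-! ### The pick-freeze estimators -/

theorem IsSample.isIID {Ω 𝓧 𝓩 Ξ : Type*} [MeasurableSpace Ω] [MeasurableSpace 𝓧]
    [MeasurableSpace 𝓩] [MeasurableSpace Ξ] {P : Measure Ω} {X : Ω → 𝓧} {Z : Ω → 𝓩} {ξ : Ω → Ξ}
    {Z' : Ω → 𝓩} {ξ' : Ω → Ξ} {Xs : ℕ → Ω → 𝓧} {Zs : ℕ → Ω → 𝓩} {ξs : ℕ → Ω → Ξ}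
    {Zs' : ℕ → Ω → 𝓩} {ξs' : ℕ → Ω → Ξ}
    (h : IsSample P X Z ξ Z' ξ' Xs Zs ξs Zs' ξs') :
    IsIID P (fun ω => (X ω, (Z ω, ξ ω), (Z' ω, ξ' ω)))
      (fun i ω => (Xs i ω, (Zs i ω, ξs i ω), (Zs' i ω, ξs' i ω))) := by
  have hm : Measurable fun p : 𝓧 × 𝓩 × Ξ × 𝓩 × Ξ =>
      (p.1, (p.2.1, p.2.2.1), (p.2.2.2.1, p.2.2.2.2)) := by fun_prop
  exact ⟨h.indep.comp (fun _ => _) (fun _ => hm), fun i => (h.identDistrib i).comp hm⟩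

end PickFreeze

open PickFreeze
theorem mainTheorem3
    {Ω 𝓧 𝓩 Ξ : Type*} [MeasurableSpace Ω] [MeasurableSpace 𝓧] [MeasurableSpace 𝓩]
    [MeasurableSpace Ξ] (P : Measure Ω) [IsProbabilityMeasure P]
    -- the generic draw and the i.i.d. sample
    (X : Ω → 𝓧) (Z : Ω → 𝓩) (ξ : Ω → Ξ) (Z' : Ω → 𝓩) (ξ' : Ω → Ξ)
    (hdraw : IsDraw P X Z ξ Z' ξ')
    (Xs : ℕ → Ω → 𝓧) (Zs : ℕ → Ω → 𝓩) (ξs : ℕ → Ω → Ξ) (Zs' : ℕ → Ω → 𝓩) (ξs' : ℕ → Ω → Ξ)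
    (hsample : IsSample P X Z ξ Z' ξ' Xs Zs ξs Zs' ξs')
    -- the exact model and the perturbations
    (f : 𝓧 → 𝓩 → ℝ) (hf : Measurable (fun p : 𝓧 × 𝓩 => f p.1 p.2))
    (δ : ℕ → 𝓧 → 𝓩 → Ξ → ℝ)
    (hδ : ∀ N, Measurable (fun p : 𝓧 × 𝓩 × Ξ => δ N p.1 p.2.1 p.2.2))
    -- `Y`, `Y^X`, the errors `δ_N`, `δ_N^X` and the quantity `C_{δ,N}`
    (Y YX : Ω → ℝ) (hY : Y = fun ω => f (X ω) (Z ω)) (hYX : YX = fun ω => f (X ω) (Z' ω))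
    (D DX : ℕ → Ω → ℝ) (hD : D = fun N ω => δ N (X ω) (Z ω) (ξ ω))
    (hDX : DX = fun N ω => δ N (X ω) (Z' ω) (ξ' ω))
    (Cδ : ℕ → ℝ) (hCδ : Cδ = fun N => correlationQuantity P Y YX (D N) (DX N))
    -- the Sobol index of the exact model and the estimators computed from the metamodel
    (S : ℝ) (hS : S = sobolIndex P X Y)
    (SN TN : ℕ → Ω → ℝ)
    (hSN : SN = fun N ω => estimatorS N
      (fun i => metamodel f (δ N) (Xs i ω) (Zs i ω) (ξs i ω))
      (fun i => metamodel f (δ N) (Xs i ω) (Zs' i ω) (ξs' i ω)))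
    (hTN : TN = fun N ω => estimatorT N
      (fun i => metamodel f (δ N) (Xs i ω) (Zs i ω) (ξs i ω))
      (fun i => metamodel f (δ N) (Xs i ω) (Zs' i ω) (ξs' i ω)))
    -- assumptions
    (hYL2 : MemLp Y 2 P) (hYvar : Var[Y; P] ≠ 0)
    (hmoment : ∃ s > (0 : ℝ), ∃ K : ℝ, ∀ N, 1 ≤ N →
      Integrable (fun ω => |metamodel f (δ N) (X ω) (Z ω) (ξ ω)| ^ (4 + s)) P ∧
        ∫ ω, |metamodel f (δ N) (X ω) (Z ω) (ξ ω)| ^ (4 + s) ∂P < K)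
    (hvar : Tendsto (fun N => Var[D N; P]) atTop (𝓝 0))
    (hC : ¬ Tendsto Cδ atTop (𝓝 0)) :
    ((fun N => Var[D N; P]) =o[atTop] (fun N : ℕ => 1 / (N : ℝ)) →
      AsympNormal P SN S 0 ⟨asympVarS P Y YX S, asympVarS_nonneg P Y YX S⟩ ∧
      AsympNormal P TN S 0 ⟨asympVarT P Y YX S, asympVarT_nonneg P Y YX S⟩) ∧
    (Tendsto (fun N : ℕ => (N : ℝ) * Var[D N; P]) atTop atTop →
      (∀ (m : ℝ) (v : ℝ≥0), ¬ AsympNormal P SN S m v) ∧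
      (∀ (m : ℝ) (v : ℝ≥0), ¬ AsympNormal P TN S m v)) ∧
    (∀ C γ : ℝ, C ≠ 0 → Tendsto Cδ atTop (𝓝 C) →
      (fun N : ℕ => Var[D N; P] - γ / (C * N)) =o[atTop] (fun N : ℕ => 1 / (N : ℝ)) →
      AsympNormal P SN S (C * √(γ / C) / Var[Y; P])
        ⟨asympVarS P Y YX S, asympVarS_nonneg P Y YX S⟩ ∧
      AsympNormal P TN S (C * √(γ / C) / Var[Y; P])
        ⟨asympVarT P Y YX S, asympVarT_nonneg P Y YX S⟩) := by
  obtain ⟨s, hs, K, hmom⟩ := hmoment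
  have hmX := hdraw.measurable_X
  have hmZ := hdraw.measurable_Z
  have hmξ := hdraw.measurable_ξ
  have hmZ' := hdraw.measurable_Z'
  have hmξ' := hdraw.measurable_ξ'
  -- a draw is regrouped as `(X, (Z, ξ), (Z', ξ'))`; the outputs are functions of it
  set W : Ω → 𝓧 × (𝓩 × Ξ) × (𝓩 × Ξ) := fun ω => (X ω, (Z ω, ξ ω), (Z' ω, ξ' ω)) with hWdef
  set Ws : ℕ → Ω → 𝓧 × (𝓩 × Ξ) × (𝓩 × Ξ) :=
    fun i ω => (Xs i ω, (Zs i ω, ξs i ω), (Zs' i ω, ξs' i ω))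
  have hW : IsIID P W Ws := hsample.isIID
  have hgm : ∀ N, Measurable fun p : 𝓧 × 𝓩 × Ξ => metamodel f (δ N) p.1 p.2.1 p.2.2 := fun N =>
    (hf.comp (measurable_fst.prodMk (measurable_fst.comp measurable_snd))).add (hδ N)
  have hfst : Measurable fun w : 𝓧 × (𝓩 × Ξ) × (𝓩 × Ξ) => (w.1, w.2.1) := by fun_prop
  have hsnd : Measurable fun w : 𝓧 × (𝓩 × Ξ) × (𝓩 × Ξ) => (w.1, w.2.2) := by fun_prop
  -- consequences of exchangeability
  have hswap := hdraw.identDistrib_swap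
  have hYm : Measurable Y := hY ▸ hf.comp (hmX.prodMk hmZ)
  have hDm : ∀ N, Measurable (D N) := fun N =>
    hD ▸ (hδ N).comp (hmX.prodMk (hmZ.prodMk hmξ))
  have idY : IdentDistrib Y YX P P := by
    rw [hY, hYX]
    exact hswap.comp (u := fun w : 𝓧 × (𝓩 × Ξ) × (𝓩 × Ξ) => f w.1 w.2.1.1)
      (hf.comp (f := fun w : 𝓧 × (𝓩 × Ξ) × (𝓩 × Ξ) => (w.1, w.2.1.1)) (by fun_prop))
  have idD : ∀ N, IdentDistrib (D N) (DX N) P P := fun N => by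
    rw [hD, hDX]
    exact hswap.comp (u := fun w : 𝓧 × (𝓩 × Ξ) × (𝓩 × Ξ) => δ N w.1 w.2.1.1 w.2.1.2)
      ((hδ N).comp hfst)
  have idM : ∀ N, IdentDistrib (fun ω => Y ω + D N ω) (fun ω => YX ω + DX N ω) P P := fun N => by
    rw [hY, hYX, hD, hDX]
    exact hswap.comp ((hgm N).comp hfst)
  have idC : ∀ N, IdentDistrib (fun ω => (Y ω, DX N ω)) (fun ω => (YX ω, D N ω)) P P :=
    fun N => by
      rw [hY, hYX, hD, hDX]
      exact hswap.comp (u := fun w : 𝓧 × (𝓩 × Ξ) × (𝓩 × Ξ) =>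
          (f w.1 w.2.1.1, δ N w.1 w.2.2.1 w.2.2.2))
        ((hf.comp (f := fun w : 𝓧 × (𝓩 × Ξ) × (𝓩 × Ξ) => (w.1, w.2.1.1)) (by fun_prop)).prodMk
          ((hδ N).comp hsnd))
  have hYXL2 : MemLp YX 2 P := idY.memLp_iff.1 hYL2
  have hcovS : cov[Y, YX; P] = S * Var[Y; P] := by
    have h := hdraw.covariance_eq_variance_condExp hf (hY ▸ hYL2) (hYX ▸ hYXL2)
      (by have := idY.integral_eq; rw [hY, hYX] at this; exact this.symm)
    rw [hS, sobolIndex, div_mul_cancel₀ _ hYvar, hY, hYX, h]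
  -- the centred outputs and their limits, as functions of a draw
  set c : ℕ → ℝ := fun N => ∫ ω, (Y ω + D N ω) ∂P with hc
  set a : ℕ → 𝓧 × (𝓩 × Ξ) × (𝓩 × Ξ) → ℝ :=
    fun N w => metamodel f (δ N) w.1 w.2.1.1 w.2.1.2 - c N with ha
  set b : ℕ → 𝓧 × (𝓩 × Ξ) × (𝓩 × Ξ) → ℝ :=
    fun N w => metamodel f (δ N) w.1 w.2.2.1 w.2.2.2 - c N with hb
  set a' : 𝓧 × (𝓩 × Ξ) × (𝓩 × Ξ) → ℝ := fun w => f w.1 w.2.1.1 - ∫ ω, Y ω ∂P with ha'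
  set b' : 𝓧 × (𝓩 × Ξ) × (𝓩 × Ξ) → ℝ := fun w => f w.1 w.2.2.1 - ∫ ω, Y ω ∂P with hb'
  have am : ∀ N, Measurable (a N) := fun N => ((hgm N).comp hfst).sub_const _
  have bm : ∀ N, Measurable (b N) := fun N => ((hgm N).comp hsnd).sub_const _
  have am' : Measurable a' :=
    (hf.comp (f := fun w : 𝓧 × (𝓩 × Ξ) × (𝓩 × Ξ) => (w.1, w.2.1.1)) (by fun_prop)).sub_const _
  have bm' : Measurable b' :=
    (hf.comp (f := fun w : 𝓧 × (𝓩 × Ξ) × (𝓩 × Ξ) => (w.1, w.2.2.1)) (by fun_prop)).sub_const _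
  have aW : ∀ N ω, a N (W ω) = Y ω + D N ω - c N := fun N ω => by
    simp only [ha, hWdef, metamodel, hY, hD]
  have bW : ∀ N ω, b N (W ω) = YX ω + DX N ω - c N := fun N ω => by
    simp only [hb, hWdef, metamodel, hYX, hDX]
  have aW' : ∀ ω, a' (W ω) = Y ω - ∫ ω, Y ω ∂P := fun ω => by simp only [ha', hWdef, hY]
  have bW' : ∀ ω, b' (W ω) = YX ω - ∫ ω, Y ω ∂P := fun ω => by simp only [hb', hWdef, hYX]
  have hmom' : ∀ N, 1 ≤ N → Integrable (fun ω => |Y ω + D N ω| ^ (4 + s)) P ∧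
      ∫ ω, |Y ω + D N ω| ^ (4 + s) ∂P < K := by
    intro N hN
    simpa only [hY, hD, metamodel] using hmom N hN
  have aL : TendstoLp P 4 (fun N ω => a N (W ω)) (fun ω => a' (W ω)) := by
    simp only [aW, aW']
    exact tendstoLp_four_centred hYL2 (fun N => (hDm N).aestronglyMeasurable) hs hmom' hvar
  have idab : ∀ N, IdentDistrib (fun ω => a N (W ω)) (fun ω => b N (W ω)) P P := fun N =>
    hswap.comp (am N)
  have idab' : IdentDistrib (fun ω => a' (W ω)) (fun ω => b' (W ω)) P P := hswap.comp am'
  have bL : TendstoLp P 4 (fun N ω => b N (W ω)) (fun ω => b' (W ω)) :=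
    ⟨aL.memLp.mono fun N h => (idab N).memLp_iff.1 h, idab'.memLp_iff.1 aL.memLp_lim,
      aL.tendsto.congr fun N => (hswap.comp ((am N).sub am')).eLpNorm_eq 4⟩
  have aL2 := aL.mono (by norm_num : (2 : ℝ≥0∞) ≤ 4)
  have bL2 := bL.mono (by norm_num : (2 : ℝ≥0∞) ≤ 4)
  have abL := aL.mul (r := 2) (by norm_num) bL
  have aaL := aL.mul (r := 2) (by norm_num) aL
  have bbL := bL.mul (r := 2) (by norm_num) bL
  -- first and second moments of the centred outputs
  have hML2 : ∀ᶠ N in atTop, MemLp (fun ω => Y ω + D N ω) 2 P := by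
    filter_upwards [aL2.memLp] with N hN
    refine (hN.add (memLp_const (c N))).ae_eq (Eventually.of_forall fun ω => ?_)
    simp [aW]
  have hDL2 : ∀ᶠ N in atTop, MemLp (D N) 2 P := by
    filter_upwards [hML2] with N hN
    refine (hN.sub hYL2).ae_eq (Eventually.of_forall fun ω => ?_)
    simp
  have a0 : ∀ᶠ N in atTop, ∫ ω, a N (W ω) ∂P = 0 := by
    filter_upwards [hML2] with N hN
    simp only [aW]
    rw [integral_sub (hN.integrable (by norm_num)) (integrable_const _)]
    simp [hc]
  have b0 : ∀ᶠ N in atTop, ∫ ω, b N (W ω) ∂P = 0 :=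
    a0.mono fun N h => (idab N).integral_eq.symm.trans h
  have haa : ∀ N, ∫ ω, a N (W ω) * a N (W ω) ∂P = Var[Y + D N; P] := fun N => by
    rw [variance_eq_integral (hYm.add (hDm N)).aemeasurable]
    simp only [aW, hc, Pi.add_apply, sq]
  have hbb : ∀ N, ∫ ω, b N (W ω) * b N (W ω) ∂P = Var[Y + D N; P] := fun N => by
    rw [← haa]
    exact (hswap.comp ((am N).mul (am N))).integral_eq.symm
  have hab : ∀ N, ∫ ω, a N (W ω) * b N (W ω) ∂P = cov[Y + D N, YX + DX N; P] := fun N => by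
    have h := (idM N).integral_eq
    simp only [covariance, aW, bW, hc, Pi.add_apply, ← h]
  have haa' : ∫ ω, a' (W ω) * a' (W ω) ∂P = Var[Y; P] := by
    rw [variance_eq_integral hYm.aemeasurable]
    simp only [aW', sq]
  have hbb' : ∫ ω, b' (W ω) * b' (W ω) ∂P = Var[Y; P] := by
    rw [← haa']
    exact (hswap.comp (am'.mul am')).integral_eq.symm
  have hdrift : ∀ᶠ N in atTop, ∫ ω, a N (W ω) * b N (W ω) ∂P
      - S * ∫ ω, a N (W ω) * a N (W ω) ∂P = √(Var[D N; P]) * Cδ N := by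
    filter_upwards [hDL2] with N hN
    have hcov : cov[D N, YX; P] = cov[Y, DX N; P] := by
      have h := ((idC N).comp (u := fun p : ℝ × ℝ => (p.1 - ∫ ω, Y ω ∂P)
        * (p.2 - ∫ ω, D N ω ∂P)) (by fun_prop)).integral_eq
      rw [covariance_comm (X := D N)]
      simp only [covariance, ← idY.integral_eq, ← (idD N).integral_eq]
      exact h.symm
    rw [hab, haa, hCδ]
    exact covariance_sub_mul_variance_eq hYL2 hYXL2 hN ((idD N).memLp_iff.1 hN) hYvar
      idY.variance_eq.symm (idD N).variance_eq.symm hcov hcovS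
  have hCB : ∀ᶠ N in atTop, |Cδ N| ≤ 4 * √(Var[Y; P]) + 2 * 1 := by
    filter_upwards [hDL2, hvar.eventually_le_const zero_lt_one] with N hN h1
    rw [hCδ]
    refine (abs_correlationQuantity_le hYL2 hYXL2 hN ((idD N).memLp_iff.1 hN)).trans ?_
    gcongr
    exact Real.sqrt_le_one.2 h1
  -- the two estimators as ratios of means of centred outputs
  have hWsm : ∀ i, AEMeasurable (Ws i) P := fun i => (hW.ident i).aemeasurable_fst
  have meanm : ∀ {k : ℕ → 𝓧 × (𝓩 × Ξ) × (𝓩 × Ξ) → ℝ}, (∀ N, Measurable (k N)) → ∀ N : ℕ,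
      AEMeasurable (fun ω => (1 / N : ℝ) * ∑ i ∈ Finset.range N, k N (Ws i ω)) P := fun hk N =>
    (Finset.aemeasurable_fun_sum _ fun i _ => (hk N).comp_aemeasurable (hWsm i)).const_mul _
  have ym : ∀ N i, AEMeasurable (fun ω => metamodel f (δ N) (Xs i ω) (Zs i ω) (ξs i ω)) P :=
    fun N i => ((hgm N).comp hfst).comp_aemeasurable (hWsm i)
  have zm : ∀ N i, AEMeasurable (fun ω => metamodel f (δ N) (Xs i ω) (Zs' i ω) (ξs' i ω)) P :=
    fun N i => ((hgm N).comp hsnd).comp_aemeasurable (hWsm i)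
  have triS := asympNormal_trichotomy (P := P) hW (u := fun N w => a N w * b N w)
    (q := fun N w => a N w * a N w) (u' := fun w => a' w * b' w) (q' := fun w => a' w * a' w)
    (fun N => (am N).mul (bm N)) (fun N => (am N).mul (am N)) (am'.mul bm') (am'.mul am')
    abL aaL (fun N => (meanm am N).mul (meanm bm N)) (fun N => (meanm am N).mul (meanm am N))
    (tendstoInMeasure_sqrt_mul_mean_mul_mean hW am bm aL2 bL2 a0 b0)
    (tendstoInMeasure_sqrt_mul_mean_mul_mean hW am am aL2 aL2 a0 a0) haa' hYvar
    (S := S) (E := SN)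
    (fun N => by
      rw [hSN]
      unfold estimatorS
      fun_prop)
    (by
      filter_upwards [eventually_ne_atTop 0] with N hN ω
      rw [hSN]
      exact estimatorS_eq_centred hN _ _ (c N))
    hCB hC hdrift (w := ⟨asympVarS P Y YX S, asympVarS_nonneg P Y YX S⟩)
    (by
      change asympVarS P Y YX S = _
      rw [asympVarS]
      congr 2
      ext ω
      rw [aW', bW']
      ring)
  -- for the second estimator, both corrections are the squared mean of `(a_N + b_N) / 2`
  have hm : ∀ N, Measurable fun w => 1 / 2 * (a N w + b N w) := fun N =>
    ((am N).add (bm N)).const_mul _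
  have hmL := (aL2.add (by norm_num) bL2).const_mul (1 / 2)
  have hm0 : ∀ᶠ N in atTop, ∫ ω, 1 / 2 * (a N (W ω) + b N (W ω)) ∂P = 0 := by
    filter_upwards [a0, b0, aL2.memLp, bL2.memLp] with N h1 h2 h3 h4
    rw [integral_const_mul, integral_add (h3.integrable (by norm_num))
      (h4.integrable (by norm_num)), h1, h2]
    norm_num
  have hmm := tendstoInMeasure_sqrt_mul_mean_mul_mean hW hm hm
    (f := fun w => 1 / 2 * (a' w + b' w)) (g := fun w => 1 / 2 * (a' w + b' w)) hmL hmL hm0 hm0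
  have triT := asympNormal_trichotomy (P := P) hW (u := fun N w => a N w * b N w)
    (q := fun N w => 1 / 2 * (a N w * a N w + b N w * b N w)) (u' := fun w => a' w * b' w)
    (q' := fun w => 1 / 2 * (a' w * a' w + b' w * b' w))
    (fun N => (am N).mul (bm N))
    (fun N => (((am N).mul (am N)).add ((bm N).mul (bm N))).const_mul _) (am'.mul bm')
    (((am'.mul am').add (bm'.mul bm')).const_mul _)
    abL ((aaL.add (by norm_num) bbL).const_mul (1 / 2))
    (fun N => (meanm hm N).mul (meanm hm N)) (fun N => (meanm hm N).mul (meanm hm N)) hmm hmm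
    (σ := Var[Y; P])
    (by
      rw [integral_const_mul, integral_add (aaL.memLp_lim.integrable (by norm_num))
        (bbL.memLp_lim.integrable (by norm_num)), haa', hbb']
      ring) hYvar
    (S := S) (E := TN)
    (fun N => by
      rw [hTN]
      unfold estimatorT
      fun_prop)
    (by
      filter_upwards [eventually_ne_atTop 0] with N hN ω
      rw [hTN]
      exact estimatorT_eq_centred hN _ _ (c N))
    hCB hC
    (by
      filter_upwards [hdrift, aaL.memLp, bbL.memLp] with N hN h1 h2
      rw [integral_const_mul, integral_add (h1.integrable (by norm_num))
        (h2.integrable (by norm_num)), ← hN, hbb, haa]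
      ring) (w := ⟨asympVarT P Y YX S, asympVarT_nonneg P Y YX S⟩)
    (by
      change asympVarT P Y YX S = _
      rw [asympVarT]
      congr 2
      ext ω
      rw [aW', bW']
      ring)
  exact ⟨fun h => ⟨triS.1 h, triT.1 h⟩, fun h => ⟨triS.2.1 h, triT.2.1 h⟩,
    fun C γ _ h1 h2 => ⟨triS.2.2 C γ h1 h2, triT.2.2 C γ h1 h2⟩⟩
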